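/- Let $(M,g)$ be an oriented smooth four-dimensional spacetime of signature $(-,+,+,+)$, with Levi-Civita connection $\nabla$ and Hodge dual $(*U)_{cd}=\tfrac12\eta_{abcd}U^{ab}$, where $\eta$ is the metric volume element. Let $U$ be a smooth unitary $2$-form, that is, $U$ is at each point a volume element of a time-like $2$-plane $V$, and let $H=V^{\perp}$; the pair $(V,H)$ is the $2+2$ structure defined by $U$. Let $\phi,\psi$ be smooth real functions on $M$, and put $$A=e^{\phi}(\cos\psi\,U+\sin\psi\,{*U}),\qquad F=e^{-2\phi}(\cos 2\psi\,U-\sin 2\psi\,{*U}).$$ Then $A$ is a conformal Killing-Yano tensor, i.e. a skew-symmetric solution of $$\nabla_{(\alpha}A_{\beta)\mu}=g_{\alpha\beta}a_\mu-a_{(\alpha}g_{\beta)\mu},\qquad 3a_\mu=\nabla^{\alpha}A_{\alpha\mu},$$ if and only if $F$ is a Maxwell field, i.e. $\nabla\cdot F=0$ and $dF=0$, and its underlying $2+2$ structure $(V,H)$ is umbilical. Here a plane field $D$ is umbilical if its symmetrized second fundamental form is proportional to the induced metric: at each point there is a vector $Z$ such that, for all vector fields $X,Y$ tangent to $D$,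 the vectors $\nabla_XY+\nabla_YX$ and $2g(X,Y)Z$ have the same component normal to $D$; the structure $(V,H)$ is umbilical if both $V$ and $H$ are. -/

import Mathlib

open scoped Manifold ContDiff

noncomputable section

namespace Spacetime

/-- The model space of a four-dimensional manifold. -/
abbrev E4 : Type := EuclideanSpace ℝ (Fin 4)

/-- The diagonal entries of the Minkowski metric of signature `(-,+,+,+)`. -/
def mink (i : Fin 4) : ℝ := if i = 0 then -1 else 1

section Fields

variable (M : Type*) [TopologicalSpace M] [ChartedSpace E4 M]

/-- Fields of bilinear forms on the tangent spaces (covariant 2-tensors). -/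
abbrev BilinField : Type _ :=
  ∀ p : M, TangentSpace (𝓡 4) p →ₗ[ℝ] TangentSpace (𝓡 4) p →ₗ[ℝ] ℝ

/-- Fields of alternating bilinear forms on the tangent spaces (skew-symmetric 2-tensors). -/
abbrev TwoForm : Type _ := ∀ p : M, (TangentSpace (𝓡 4) p) [⋀^Fin 2]→ₗ[ℝ] ℝ

/-- Fields of alternating 4-forms on the tangent spaces. -/
abbrev FourForm : Type _ := ∀ p : M, (TangentSpace (𝓡 4) p) [⋀^Fin 4]→ₗ[ℝ] ℝ

/-- Fields of subsets (in practice: of planes) of the tangent spaces. -/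
abbrev PlaneField : Type _ := ∀ p : M, Set (TangentSpace (𝓡 4) p)

end Fields

variable {M : Type*} [TopologicalSpace M] [ChartedSpace E4 M]

/-! ### Components in a chart -/

/-- The coordinate vector `∂ᵢ` of the chart `e`, at the point with coordinates `x`. -/
def frame (e : OpenPartialHomeomorph M E4) (x : E4) (i : Fin 4) :
    TangentSpace (𝓡 4) (e.symm x) :=
  mfderiv (𝓡 4) (𝓡 4) e.symm x (EuclideanSpace.single i (1 : ℝ) : E4)

/-- The tangent vector `∑ᵢ cⁱ ∂ᵢ` at the point with coordinates `x`. -/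
def vec (e : OpenPartialHomeomorph M E4) (x : E4) (c : Fin 4 → ℝ) :
    TangentSpace (𝓡 4) (e.symm x) :=
  ∑ i, c i • frame e x i

/-- The matrix `T_{ij}` of components of a bilinear field, as a function of the coordinates. -/
def bilinComp (T : BilinField M) (e : OpenPartialHomeomorph M E4) (x : E4) :
    Matrix (Fin 4) (Fin 4) ℝ :=
  Matrix.of fun i j => T (e.symm x) (frame e x i) (frame e x j)

/-- The matrix `A_{ij}` of components of a 2-form, as a function of the coordinates. -/
def formComp (A : TwoForm M) (e : OpenPartialHomeomorph M E4) (x : E4) :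
    Matrix (Fin 4) (Fin 4) ℝ :=
  Matrix.of fun i j => A (e.symm x) ![frame e x i, frame e x j]

/-- A 2-form is smooth if its components in every chart are. -/
def TwoForm.IsSmooth (A : TwoForm M) : Prop :=
  ∀ e ∈ atlas E4 M, ∀ i j, ContDiffOn ℝ ∞ (fun x => formComp A e x i j) e.target

/-! ### Levi-Civita calculus in coordinates

`G` is the matrix of components of the metric, as a function of the coordinates. -/

/-- The partial derivative `∂ᵢ f`. -/
def pd (i : Fin 4) (f : E4 → ℝ) (x : E4) : ℝ :=
  fderiv ℝ f x (EuclideanSpace.single i (1 : ℝ))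

/-- The Christoffel symbols `Γᵏᵢⱼ` of the metric `G`. -/
def christoffel (G : E4 → Matrix (Fin 4) (Fin 4) ℝ) (x : E4) (k i j : Fin 4) : ℝ :=
  1 / 2 * ∑ l, (G x)⁻¹ k l *
    (pd i (fun y => G y j l) x + pd j (fun y => G y i l) x - pd l (fun y => G y i j) x)

/-- The covariant derivative `∇ₖ T_{ij}` of a covariant 2-tensor. -/
def nablaForm (G T : E4 → Matrix (Fin 4) (Fin 4) ℝ) (x : E4) (k i j : Fin 4) : ℝ :=
  pd k (fun y => T y i j) x - ∑ l, christoffel G x l k i * T x l j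
    - ∑ l, christoffel G x l k j * T x i l

/-- The divergence `(∇·T)_j = gᵏⁱ ∇ₖ T_{ij}`. -/
def divForm (G T : E4 → Matrix (Fin 4) (Fin 4) ℝ) (x : E4) (j : Fin 4) : ℝ :=
  ∑ k, ∑ i, (G x)⁻¹ k i * nablaForm G T x k i j

/-- The component `k` of the covariant derivative `∇_X Y` of vector fields. -/
def nablaVec (G : E4 → Matrix (Fin 4) (Fin 4) ℝ) (X Y : E4 → Fin 4 → ℝ) (x : E4)
    (k : Fin 4) : ℝ :=
  ∑ i, X x i * (pd i (fun y => Y y k) x + ∑ j, christoffel G x k i j * Y x j)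

end Spacetime

open Spacetime

/-- An oriented Lorentzian metric of signature `(-,+,+,+)` on a four-dimensional manifold: the
metric tensor `g` and its volume element `η`, both smooth. The orientation is the one for which
`η` is positive; `η` takes the value `1` on some orthonormal frame at each point, hence on every
positively oriented one. -/
structure Spacetime (M : Type*) [TopologicalSpace M] [ChartedSpace E4 M] where
  /-- The metric tensor. -/
  g : BilinField M
  /-- The metric volume element. -/
  η : FourForm M
  g_smooth : ∀ e ∈ atlas E4 M, ∀ i j, ContDiffOn ℝ ∞ (fun x => bilinComp g e x i j) e.target
  η_smooth : ∀ e ∈ atlas E4 M, ContDiffOn ℝ ∞ (fun x => η (e.symm x) (frame e x)) e.target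
  exists_frame : ∀ p, ∃ b : Module.Basis (Fin 4) ℝ (TangentSpace (𝓡 4) p),
    (∀ i j, g p (b i) (b j) = if i = j then mink i else 0) ∧ η p b = 1

namespace Spacetime

variable {M : Type*} [TopologicalSpace M] [ChartedSpace E4 M] (S : Spacetime M)

/-- A positively oriented orthonormal frame at `p`. -/
def orthoFrame (p : M) : Module.Basis (Fin 4) ℝ (TangentSpace (𝓡 4) p) :=
  (S.exists_frame p).choose

/-- The Hodge dual `(*A)_{cd} = ½ η_{abcd} A^{ab}` of a 2-form, computed in a positively oriented
orthonormal frame. -/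
def hodge (A : TwoForm M) : TwoForm M := fun p =>
  (1 / 2 : ℝ) • ∑ a, ∑ b,
    (mink a * mink b * A p ![S.orthoFrame p a, S.orthoFrame p b]) •
      ((S.η p).curryLeft (S.orthoFrame p a)).curryLeft (S.orthoFrame p b)

/-- A smooth unitary 2-form: at each point it is the volume element of a time-like plane, namely
of the one spanned by the orthonormal vectors `u` (time-like) and `w` (space-like). -/
structure IsUnitary (U : TwoForm M) : Prop where
  smooth : U.IsSmooth
  unitary : ∀ p, ∃ u w : TangentSpace (𝓡 4) p,
    S.g p u u = -1 ∧ S.g p w w = 1 ∧ S.g p u w = 0 ∧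
      ∀ x y, U p ![x, y] = S.g p u x * S.g p w y - S.g p w x * S.g p u y

/-- The space-like plane `H` of the 2+2 structure defined by `U`: the kernel of `U`. -/
def spacePlane (U : TwoForm M) : PlaneField M := fun p => {x | ∀ y, U p ![x, y] = 0}

/-- The time-like plane `V` of the 2+2 structure defined by `U`: the orthogonal complement of the
kernel of `U`. -/
def timePlane (U : TwoForm M) : PlaneField M := fun p => {x | ∀ y ∈ spacePlane U p, S.g p x y = 0}

/-- A plane field `D` is umbilical if its (symmetrized) second fundamental form is proportional to
the induced metric: at each point there is a vector `Z` such that for all smooth vector fields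
`X`, `Y` tangent to `D` the vectors `∇_X Y + ∇_Y X` and `2 g(X, Y) Z` have the same component
normal to `D`, that is, their difference lies in `D`. -/
def IsUmbilicalPlane (D : PlaneField M) : Prop :=
  ∀ e ∈ atlas E4 M, ∀ x ∈ e.target, ∃ Z : Fin 4 → ℝ, ∀ X Y : E4 → Fin 4 → ℝ,
    ContDiffOn ℝ ∞ X e.target → ContDiffOn ℝ ∞ Y e.target →
    (∀ y ∈ e.target, vec e y (X y) ∈ D (e.symm y)) →
    (∀ y ∈ e.target, vec e y (Y y) ∈ D (e.symm y)) →
    vec e x (fun k => nablaVec (bilinComp S.g e) X Y x k + nablaVec (bilinComp S.g e) Y X x k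
      - 2 * S.g (e.symm x) (vec e x (X x)) (vec e x (Y x)) * Z k) ∈ D (e.symm x)

/-- The 2+2 structure defined by the unitary 2-form `U` is umbilical if both planes are. -/
def IsUmbilical (U : TwoForm M) : Prop :=
  S.IsUmbilicalPlane (S.timePlane U) ∧ S.IsUmbilicalPlane (spacePlane U)

/-- A (smooth) conformal Killing-Yano tensor: a skew-symmetric tensor such that
`∇_{(k} A_{i)j} = g_{ki} a_j - a_{(k} g_{i)j}` with `3 a = ∇·A`. -/
structure IsCKY (A : TwoForm M) : Prop where
  smooth : A.IsSmooth
  eqn : ∀ e ∈ atlas E4 M, ∀ x ∈ e.target, ∀ k i j,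
    let G := bilinComp S.g e
    let a : Fin 4 → ℝ := fun l => 1 / 3 * divForm G (formComp A e) x l
    1 / 2 * (nablaForm G (formComp A e) x k i j + nablaForm G (formComp A e) x i k j) =
      G x k i * a j - 1 / 2 * (a k * G x i j + a i * G x k j)

/-- A (smooth) Maxwell field: a 2-form solving the source-free Maxwell equations `∇·F = 0`,
`dF = 0`. -/
structure IsMaxwell (F : TwoForm M) : Prop where
  smooth : F.IsSmooth
  div_eq_zero : ∀ e ∈ atlas E4 M, ∀ x ∈ e.target, ∀ j,
    divForm (bilinComp S.g e) (formComp F e) x j = 0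
  closed : ∀ e ∈ atlas E4 M, ∀ x ∈ e.target, ∀ i j k,
    pd i (fun y => formComp F e y j k) x + pd j (fun y => formComp F e y k i) x
      + pd k (fun y => formComp F e y i j) x = 0

end Spacetime

end

open Spacetime

/-! Write `N = ∇U` and `L = ∇*U`. Differentiating the algebraic relations `U g⁻¹ *U = 0` and `U g⁻¹
U - *U g⁻¹ *U = g` shows that `N` has only components mixing `V` and `H`, and that `L = *N`
(`mixed_of_constraints`). Since `**U = -U`, the derivative of `A` is the duality rotation `e^φ (cos
ψ + sin ψ *)` applied to `X = N + dφ U + dψ *U`. As `F` has the same shape with `-2φ`, `-2ψ` in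
place of `φ`, `ψ`, its derivative is a rescaled duality rotation of `Y = N - 2 dφ U - 2 dψ *U`.

The conformal Killing-Yano and Maxwell conditions are linear in the derivative and stable under `*`.
Because `** = -1`, a nonzero combination `a + b *` is invertible, so the rotations can be removed
(`rotation_iff`): it remains to compare the first condition on `X` with the second on `Y`.

In an orthonormal frame adapted to `V` and `H`, the first condition prescribes each of the sixteen
mixed components of `N` as plus or minus a component of `dφ` or `dψ`. These equations come in eight
pairs. In each pair one of the sum and the difference is free of `φ` and `ψ`, and says that a
trace-free symmetric part of a second fundamental form vanishes: these eight equations are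
umbilicity. The other combination fixes a trace or an antisymmetric part as twice a derivative of
`φ` or `ψ`, and is a Maxwell equation for `Y`. The factor `-2` in `F` is thus the dimension of the
planes. This is `CKYAt_iff_adapted`, a linear equivalence at a point.

The rest reduces the geometric statement to it: covariance under change of frame, existence of
adapted frames, the Leibniz rule for `∇`, and the identity `B(∇_X Y) = -(∇_X B) Y` for fields in the
kernel of `B`, which turns umbilicity of `H = ker U` and `V = ker *U` into conditions on `N` and
`L`. -/

noncomputable section

namespace Spacetime

/-! ### Algebra at a point -/

/-- The trace `gᵏⁱ T_{kij}` of a 3-index array. -/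
def trace₃ (G : Matrix (Fin 4) (Fin 4) ℝ) (T : Fin 4 → Matrix (Fin 4) (Fin 4) ℝ) (j : Fin 4) : ℝ :=
  ∑ k, ∑ i, G⁻¹ k i * T k i j

/-- The algebraic condition imposed by the conformal Killing-Yano equation on `∇A`. -/
def CKYAt (G : Matrix (Fin 4) (Fin 4) ℝ) (T : Fin 4 → Matrix (Fin 4) (Fin 4) ℝ) : Prop :=
  ∀ k i j, 1 / 2 * (T k i j + T i k j) = G k i * (1 / 3 * trace₃ G T j)
    - 1 / 2 * ((1 / 3 * trace₃ G T k) * G i j + (1 / 3 * trace₃ G T i) * G k j)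

/-- The algebraic condition imposed by the Maxwell equations on `∇F`. -/
def MaxwellAt (G : Matrix (Fin 4) (Fin 4) ℝ) (T : Fin 4 → Matrix (Fin 4) (Fin 4) ℝ) : Prop :=
  (∀ j, trace₃ G T j = 0) ∧ ∀ i j k, T i j k + T j k i + T k i j = 0

/-- The condition on `N = ∇B` under which the kernel of the 2-form `B` is umbilical. -/
def UmbilicalAt (G B : Matrix (Fin 4) (Fin 4) ℝ) (N : Fin 4 → Matrix (Fin 4) (Fin 4) ℝ) : Prop :=
  ∃ Z : Fin 4 → ℝ, ∀ X Y : Fin 4 → ℝ, B.mulVec X = 0 → B.mulVec Y = 0 → ∀ i,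
    (∑ k, ∑ j, (X k * Y j + Y k * X j) * N k i j)
      + 2 * (∑ k, ∑ j, X k * Y j * G k j) * (B.mulVec Z) i = 0

/-- The Minkowski metric. -/
def minkMatrix : Matrix (Fin 4) (Fin 4) ℝ := Matrix.diagonal mink

/-- The volume element of the plane spanned by the first two vectors of the standard frame. -/
def timeForm : Matrix (Fin 4) (Fin 4) ℝ := !![0, -1, 0, 0; 1, 0, 0, 0; 0, 0, 0, 0; 0, 0, 0, 0]

/-- The volume element of the plane spanned by the last two vectors of the standard frame. -/
def spaceForm : Matrix (Fin 4) (Fin 4) ℝ := !![0, 0, 0, 0; 0, 0, 0, 0; 0, 0, 0, -1; 0, 0, 1, 0]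

/-- The Hodge dual of a skew-symmetric matrix in the standard frame. -/
def starMatrix (A : Matrix (Fin 4) (Fin 4) ℝ) : Matrix (Fin 4) (Fin 4) ℝ :=
  !![0, -A 2 3, A 1 3, -A 1 2; A 2 3, 0, A 0 3, -A 0 2;
    -A 1 3, -A 0 3, 0, A 0 1; A 1 2, A 0 2, -A 0 1, 0]

/-! ### Component form of the equations in an orthonormal frame, and duality invariance. -/

theorem minkMatrix_mul_self : minkMatrix * minkMatrix = 1 := by
  rw [minkMatrix, Matrix.diagonal_mul_diagonal, ← Matrix.diagonal_one]
  congr 1; ext i; fin_cases i <;> norm_num [mink]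

theorem minkMatrix_inv : minkMatrix⁻¹ = minkMatrix :=
  Matrix.inv_eq_left_inv minkMatrix_mul_self

theorem trace₃_minkMatrix (T : Fin 4 → Matrix (Fin 4) (Fin 4) ℝ) (j : Fin 4) :
    trace₃ minkMatrix T j = -T 0 0 j + T 1 1 j + T 2 2 j + T 3 3 j := by
  simp only [trace₃, minkMatrix_inv]
  simp [minkMatrix, Fin.sum_univ_four, mink]

/-- For `k ≠ j` the equation with indices `k k j` reads `T k k j = mink k * a j`; eliminating `a j`
leaves two equations for each `j`. For distinct indices the metric terms vanish, so `T` is totally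
antisymmetric there, which gives two equations for each of the four triples. -/
theorem CKYAt_minkMatrix_iff {T : Fin 4 → Matrix (Fin 4) (Fin 4) ℝ}
    (hT : ∀ k i j, T k j i = -T k i j) :
    CKYAt minkMatrix T ↔
      (T 2 2 0 = T 1 1 0 ∧ T 3 3 0 = T 1 1 0 ∧ T 2 2 1 = -T 0 0 1 ∧ T 3 3 1 = -T 0 0 1 ∧
        T 1 1 2 = -T 0 0 2 ∧ T 3 3 2 = -T 0 0 2 ∧ T 1 1 3 = -T 0 0 3 ∧ T 2 2 3 = -T 0 0 3) ∧
      (T 1 2 0 = T 0 1 2 ∧ T 2 0 1 = T 0 1 2 ∧ T 1 3 0 = T 0 1 3 ∧ T 3 0 1 = T 0 1 3 ∧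
        T 2 3 0 = T 0 2 3 ∧ T 3 0 2 = T 0 2 3 ∧ T 2 3 1 = T 1 2 3 ∧ T 3 1 2 = T 1 2 3) := by
  have h0 : ∀ k i, T k i i = 0 := fun k i => by linarith [hT k i i]
  have s10 := fun k => hT k 0 1
  have s20 := fun k => hT k 0 2
  have s30 := fun k => hT k 0 3
  have s21 := fun k => hT k 1 2
  have s31 := fun k => hT k 1 3
  have s32 := fun k => hT k 2 3
  constructor
  · intro h
    have e : ∀ k i j, 1 / 2 * (T k i j + T i k j) = minkMatrix k i * (1 / 3 *
        (-T 0 0 j + T 1 1 j + T 2 2 j + T 3 3 j))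
      - 1 / 2 * ((1 / 3 * (-T 0 0 k + T 1 1 k + T 2 2 k + T 3 3 k)) * minkMatrix i j
        + (1 / 3 * (-T 0 0 i + T 1 1 i + T 2 2 i + T 3 3 i)) * minkMatrix k j) := by
      simpa only [CKYAt, trace₃_minkMatrix] using h
    have d : ∀ k j, k ≠ j → T k k j = mink k * (1 / 3 *
        (-T 0 0 j + T 1 1 j + T 2 2 j + T 3 3 j)) := fun k j hkj => by
      have := e k k j
      simp only [minkMatrix, Matrix.diagonal_apply, hkj, if_true, if_false] at this
      linarith
    have o : ∀ k i j, k ≠ i → i ≠ j → k ≠ j → T k i j + T i k j = 0 := fun k i j h1 h2 h3 => by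
      have := e k i j
      simp only [minkMatrix, Matrix.diagonal_apply, h1, h2, h3, if_false] at this
      linarith
    refine ⟨?_, ?_⟩
    · have := d 1 0; have := d 2 0; have := d 3 0; have := d 0 1; have := d 2 1; have := d 3 1
      have := d 0 2; have := d 1 2; have := d 3 2; have := d 0 3; have := d 1 3; have := d 2 3
      simp [mink] at *
      refine ⟨?_, ?_, ?_, ?_, ?_, ?_, ?_, ?_⟩ <;> linarith
    · have a1 := o 0 1 2 (by decide) (by decide) (by decide)
      have a2 := o 0 2 1 (by decide) (by decide) (by decide)
      have a3 := o 0 1 3 (by decide) (by decide) (by decide)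
      have a4 := o 0 3 1 (by decide) (by decide) (by decide)
      have a5 := o 0 2 3 (by decide) (by decide) (by decide)
      have a6 := o 0 3 2 (by decide) (by decide) (by decide)
      have a7 := o 1 2 3 (by decide) (by decide) (by decide)
      have a8 := o 1 3 2 (by decide) (by decide) (by decide)
      simp only [s10, s20, s30, s21, s31, s32] at *
      refine ⟨?_, ?_, ?_, ?_, ?_, ?_, ?_, ?_⟩ <;> linarith
  · rintro ⟨⟨a1, a2, a3, a4, a5, a6, a7, a8⟩, b1, b2, b3, b4, b5, b6, b7, b8⟩ k i j
    simp only [trace₃_minkMatrix]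
    simp only [s10, s20, s30, s21, s31, s32] at a1 a2 a3 a4 a5 a6 a7 a8 b1 b2 b3 b4 b5 b6 b7 b8
    fin_cases k <;> fin_cases i <;> fin_cases j <;>
      simp [minkMatrix, mink, h0, s10, s20, s30, s21, s31, s32] <;>
      linarith

theorem MaxwellAt_minkMatrix_iff {T : Fin 4 → Matrix (Fin 4) (Fin 4) ℝ}
    (hT : ∀ k i j, T k j i = -T k i j) :
    MaxwellAt minkMatrix T ↔
      (T 1 0 1 + T 2 0 2 + T 3 0 3 = 0 ∧ -T 0 0 1 - T 2 1 2 - T 3 1 3 = 0 ∧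
        -T 0 0 2 + T 1 1 2 - T 3 2 3 = 0 ∧ -T 0 0 3 + T 1 1 3 + T 2 2 3 = 0) ∧
      (T 0 1 2 - T 1 0 2 + T 2 0 1 = 0 ∧ T 0 1 3 - T 1 0 3 + T 3 0 1 = 0 ∧
        T 0 2 3 - T 2 0 3 + T 3 0 2 = 0 ∧ T 1 2 3 - T 2 1 3 + T 3 1 2 = 0) := by
  have h0 : ∀ k i, T k i i = 0 := fun k i => by linarith [hT k i i]
  have s10 := fun k => hT k 0 1
  have s20 := fun k => hT k 0 2
  have s30 := fun k => hT k 0 3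
  have s21 := fun k => hT k 1 2
  have s31 := fun k => hT k 1 3
  have s32 := fun k => hT k 2 3
  constructor
  · rintro ⟨h, c⟩
    have e0 := h 0; have e1 := h 1; have e2 := h 2; have e3 := h 3
    have c0 := c 0 1 2; have c1 := c 0 1 3; have c2 := c 0 2 3; have c3 := c 1 2 3
    simp only [trace₃_minkMatrix, s10, s20, s30, s21, s31, s32, h0] at *
    refine ⟨⟨?_, ?_, ?_, ?_⟩, ?_, ?_, ?_, ?_⟩ <;> linarith
  · rintro ⟨⟨a1, a2, a3, a4⟩, b1, b2, b3, b4⟩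
    refine ⟨fun j => ?_, fun i j k => ?_⟩
    · rw [trace₃_minkMatrix]
      fin_cases j <;> simp [h0, s10, s20, s30, s21, s31, s32] <;> linarith
    · fin_cases k <;> fin_cases i <;> fin_cases j <;>
      simp [h0, s10, s20, s30, s21, s31, s32] <;> linarith

theorem starMatrix_skew (A : Matrix (Fin 4) (Fin 4) ℝ) (i j : Fin 4) :
    starMatrix A j i = -starMatrix A i j := by
  fin_cases i <;> fin_cases j <;> simp [starMatrix]

/-- Duality exchanges the eight trace equations with the eight antisymmetry equations, up to sign.
-/
theorem CKYAt.star {T : Fin 4 → Matrix (Fin 4) (Fin 4) ℝ}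
    (hT : ∀ k i j, T k j i = -T k i j) (h : CKYAt minkMatrix T) :
    CKYAt minkMatrix fun k => starMatrix (T k) := by
  rw [CKYAt_minkMatrix_iff hT] at h
  rw [CKYAt_minkMatrix_iff fun k => starMatrix_skew (T k)]
  have s10 := fun k => hT k 0 1
  have s20 := fun k => hT k 0 2
  have s30 := fun k => hT k 0 3
  have s21 := fun k => hT k 1 2
  have s31 := fun k => hT k 1 3
  have s32 := fun k => hT k 2 3
  obtain ⟨⟨a1, a2, a3, a4, a5, a6, a7, a8⟩, b1, b2, b3, b4, b5, b6, b7, b8⟩ := h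
  simp only [s10, s20, s30, s21, s31, s32] at *
  simp only [starMatrix, Matrix.of_apply, Matrix.cons_val]
  refine ⟨⟨?_, ?_, ?_, ?_, ?_, ?_, ?_, ?_⟩, ?_, ?_, ?_, ?_, ?_, ?_, ?_, ?_⟩ <;> linarith

/-- Duality exchanges the divergence equations with the closedness equations. -/
theorem MaxwellAt.star {T : Fin 4 → Matrix (Fin 4) (Fin 4) ℝ}
    (hT : ∀ k i j, T k j i = -T k i j) (h : MaxwellAt minkMatrix T) :
    MaxwellAt minkMatrix fun k => starMatrix (T k) := by
  rw [MaxwellAt_minkMatrix_iff hT] at h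
  rw [MaxwellAt_minkMatrix_iff fun k => starMatrix_skew (T k)]
  obtain ⟨⟨a1, a2, a3, a4⟩, b1, b2, b3, b4⟩ := h
  simp only [starMatrix, Matrix.of_apply, Matrix.cons_val]
  refine ⟨⟨?_, ?_, ?_, ?_⟩, ?_, ?_, ?_, ?_⟩ <;> linarith

theorem trace₃_comb (G : Matrix (Fin 4) (Fin 4) ℝ) (S T : Fin 4 → Matrix (Fin 4) (Fin 4) ℝ)
    (a b : ℝ) (j : Fin 4) :
    trace₃ G (fun k => a • S k + b • T k) j = a * trace₃ G S j + b * trace₃ G T j := by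
  simp only [trace₃, Finset.mul_sum, ← Finset.sum_add_distrib]
  refine Finset.sum_congr rfl fun k _ => Finset.sum_congr rfl fun i _ => ?_
  simp only [Matrix.add_apply, Matrix.smul_apply, smul_eq_mul]; ring

theorem CKYAt.comb {G : Matrix (Fin 4) (Fin 4) ℝ} {S T : Fin 4 → Matrix (Fin 4) (Fin 4) ℝ}
    (hS : CKYAt G S) (hT : CKYAt G T) (a b : ℝ) : CKYAt G fun k => a • S k + b • T k := by
  intro k i j
  simp only [trace₃_comb, Matrix.add_apply, Matrix.smul_apply, smul_eq_mul]
  linear_combination a * hS k i j + b * hT k i j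

theorem MaxwellAt.comb {G : Matrix (Fin 4) (Fin 4) ℝ} {S T : Fin 4 → Matrix (Fin 4) (Fin 4) ℝ}
    (hS : MaxwellAt G S) (hT : MaxwellAt G T) (a b : ℝ) :
    MaxwellAt G fun k => a • S k + b • T k := by
  refine ⟨fun j => ?_, fun i j k => ?_⟩
  · rw [trace₃_comb, hS.1, hT.1]; ring
  · simp only [Matrix.add_apply, Matrix.smul_apply, smul_eq_mul]
    linear_combination a * hS.2 i j k + b * hT.2 i j k

theorem starMatrix_comb_starMatrix {A : Matrix (Fin 4) (Fin 4) ℝ} (hA : ∀ i j, A j i = -A i j)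
    (a b : ℝ) : starMatrix (a • A + b • starMatrix A) = (-b) • A + a • starMatrix A := by
  have h0 : ∀ i, A i i = 0 := fun i => by linarith [hA i i]
  ext i j
  fin_cases i <;> fin_cases j <;>
    simp [starMatrix, h0, hA 0 1, hA 0 2, hA 0 3, hA 1 2, hA 1 3, hA 2 3] <;> ring

/-- A star-invariant linear condition is invariant under duality rotations. -/
theorem rotation_iff {P : (Fin 4 → Matrix (Fin 4) (Fin 4) ℝ) → Prop}
    (hstar : ∀ T : Fin 4 → Matrix (Fin 4) (Fin 4) ℝ, (∀ k i j, T k j i = -T k i j) → P T →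
      P fun k => starMatrix (T k))
    (hcomb : ∀ S T, P S → P T → ∀ a b : ℝ, P fun k => a • S k + b • T k)
    {T : Fin 4 → Matrix (Fin 4) (Fin 4) ℝ} (hT : ∀ k i j, T k j i = -T k i j) {a b : ℝ}
    (hab : a ^ 2 + b ^ 2 ≠ 0) :
    P (fun k => a • T k + b • starMatrix (T k)) ↔ P T := by
  refine ⟨fun h => ?_, fun h => hcomb _ _ h (hstar T hT h) a b⟩
  have hs := hstar _ (fun k i j => by
    simp only [Matrix.add_apply, Matrix.smul_apply, smul_eq_mul, hT k i j,
      starMatrix_skew (T k) i j]; ring) h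
  -- Since `** = -1`, the inverse of `a + b *` is `(a - b *) / (a ^ 2 + b ^ 2)`.
  have := hcomb _ _ h hs (a / (a ^ 2 + b ^ 2)) (-b / (a ^ 2 + b ^ 2))
  convert this using 1
  funext k
  rw [starMatrix_comb_starMatrix (hT k)]
  ext i j
  simp only [Matrix.add_apply, Matrix.smul_apply, smul_eq_mul]
  field_simp
  ring

/-- The kernel is spanned by the last two frame vectors. The vector `Z` absorbs the trace of the
second fundamental form, so only the vanishing of its trace-free symmetric part is left. -/
theorem UmbilicalAt_timeForm_iff {N : Fin 4 → Matrix (Fin 4) (Fin 4) ℝ}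
    (hN : ∀ k i j, N k j i = -N k i j) (h23 : ∀ k, N k 2 3 = 0) :
    UmbilicalAt minkMatrix timeForm N ↔
      N 2 0 2 = N 3 0 3 ∧ N 2 1 2 = N 3 1 3 ∧ N 2 0 3 + N 3 0 2 = 0 ∧ N 2 1 3 + N 3 1 2 = 0 := by
  have h0 : ∀ k i, N k i i = 0 := fun k i => by linarith [hN k i i]
  have h32 : ∀ k, N k 3 2 = 0 := fun k => by rw [hN, h23, neg_zero]
  constructor
  · rintro ⟨Z, hZ⟩
    have k2 : timeForm.mulVec ![0, 0, 1, 0] = 0 := by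
      ext i; fin_cases i <;> simp [timeForm, Matrix.mulVec, dotProduct, Fin.sum_univ_four]
    have k3 : timeForm.mulVec ![0, 0, 0, 1] = 0 := by
      ext i; fin_cases i <;> simp [timeForm, Matrix.mulVec, dotProduct, Fin.sum_univ_four]
    have e22 := hZ _ _ k2 k2
    have e33 := hZ _ _ k3 k3
    have e23 := hZ _ _ k2 k3
    simp [Fin.sum_univ_four, minkMatrix, mink] at e22 e33 e23
    refine ⟨?_, ?_, ?_, ?_⟩ <;>
    linarith [e22 0, e22 1, e33 0, e33 1, e23 0, e23 1]
  · rintro ⟨a1, a2, a3, a4⟩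
    -- As `timeForm` sends `Z` to `(-Z 1, Z 0, 0, 0)`, this `Z` is forced by the case where `X` and
    -- `Y` are both the third frame vector.
    refine ⟨![-N 2 1 2, N 2 0 2, 0, 0], fun X Y hX hY i => ?_⟩
    have x0 := congrFun hX 1
    have x1 := congrFun hX 0
    have y0 := congrFun hY 1
    have y1 := congrFun hY 0
    simp [timeForm, Matrix.mulVec, dotProduct, Fin.sum_univ_four] at x0 x1 y0 y1
    have a3' : N 3 0 2 = -N 2 0 3 := by linarith
    have a4' : N 3 1 2 = -N 2 1 3 := by linarith
    fin_cases i <;> simp [timeForm, Matrix.mulVec, dotProduct, Fin.sum_univ_four, minkMatrix, mink,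
      Matrix.diagonal_apply, x0, x1, y0, y1, h0, h23, h32, ← a1, ← a2, a3', a4'] <;> ring

theorem UmbilicalAt_spaceForm_iff {L : Fin 4 → Matrix (Fin 4) (Fin 4) ℝ}
    (hL : ∀ k i j, L k j i = -L k i j) (h01 : ∀ k, L k 0 1 = 0) :
    UmbilicalAt minkMatrix spaceForm L ↔
      L 0 0 2 = -L 1 1 2 ∧ L 0 0 3 = -L 1 1 3 ∧ L 0 1 2 + L 1 0 2 = 0 ∧ L 0 1 3 + L 1 0 3 = 0 := by
  have h0 : ∀ k i, L k i i = 0 := fun k i => by linarith [hL k i i]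
  have h10 : ∀ k, L k 1 0 = 0 := fun k => by rw [hL, h01, neg_zero]
  have s20 := fun k => hL k 0 2
  have s30 := fun k => hL k 0 3
  have s21 := fun k => hL k 1 2
  have s31 := fun k => hL k 1 3
  constructor
  · rintro ⟨Z, hZ⟩
    have k0 : spaceForm.mulVec ![1, 0, 0, 0] = 0 := by
      ext i; fin_cases i <;> simp [spaceForm, Matrix.mulVec, dotProduct, Fin.sum_univ_four]
    have k1 : spaceForm.mulVec ![0, 1, 0, 0] = 0 := by
      ext i; fin_cases i <;> simp [spaceForm, Matrix.mulVec, dotProduct, Fin.sum_univ_four]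
    have e00 := hZ _ _ k0 k0
    have e11 := hZ _ _ k1 k1
    have e01 := hZ _ _ k0 k1
    simp [Fin.sum_univ_four, minkMatrix, mink] at e00 e11 e01
    have := e00 2; have := e00 3; have := e11 2; have := e11 3; have := e01 2; have := e01 3
    simp only [s20, s30, s21, s31] at *
    refine ⟨?_, ?_, ?_, ?_⟩ <;> linarith
  · rintro ⟨a1, a2, a3, a4⟩
    -- As `spaceForm` sends `Z` to `(0, 0, -Z 3, Z 2)`, this `Z` is forced by the case where `X` and
    -- `Y` are both the second frame vector.
    refine ⟨![0, 0, L 1 1 3, -L 1 1 2], fun X Y hX hY i => ?_⟩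
    have x2 := congrFun hX 3
    have x3 := congrFun hX 2
    have y2 := congrFun hY 3
    have y3 := congrFun hY 2
    simp [spaceForm, Matrix.mulVec, dotProduct, Fin.sum_univ_four] at x2 x3 y2 y3
    have a3' : L 0 1 2 = -L 1 0 2 := by linarith
    have a4' : L 0 1 3 = -L 1 0 3 := by linarith
    fin_cases i <;> simp [spaceForm, Matrix.mulVec, dotProduct, Fin.sum_univ_four, minkMatrix, mink,
      Matrix.diagonal_apply, x2, x3, y2, y3, h0, h01, h10, s20, s30, s21, s31, a1, a2, a3', a4']
      <;> ring

theorem starMatrix_timeForm : starMatrix timeForm = spaceForm := by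
  ext i j; fin_cases i <;> fin_cases j <;> simp [starMatrix, timeForm, spaceForm]

theorem starMatrix_spaceForm : starMatrix spaceForm = -timeForm := by
  ext i j; fin_cases i <;> fin_cases j <;> simp [starMatrix, timeForm, spaceForm]

/-- The covariant derivative of the volume form of the time-like plane is mixed, and the one of the
volume form of the space-like plane is its Hodge dual. -/
theorem mixed_of_constraints {N L : Matrix (Fin 4) (Fin 4) ℝ}
    (hN : ∀ i j, N j i = -N i j) (hL : ∀ i j, L j i = -L i j)
    (h1 : N * minkMatrix * spaceForm + timeForm * minkMatrix * L = 0)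
    (h2 : N * minkMatrix * timeForm + timeForm * minkMatrix * N
      - (L * minkMatrix * spaceForm + spaceForm * minkMatrix * L) = 0) :
    N 0 1 = 0 ∧ N 2 3 = 0 ∧ L = starMatrix N := by
  have l0 : ∀ i, L i i = 0 := fun i => by linarith [hL i i]
  have p : ∀ i j, (N * minkMatrix * spaceForm + timeForm * minkMatrix * L) i j = 0 :=
    fun i j => by rw [h1]; rfl
  have q : ∀ i j, (N * minkMatrix * timeForm + timeForm * minkMatrix * N
      - (L * minkMatrix * spaceForm + spaceForm * minkMatrix * L)) i j = 0 :=
    fun i j => by rw [h2]; rfl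
  simp only [Matrix.mul_apply, Matrix.sub_apply, Matrix.add_apply, Fin.sum_univ_four] at p q
  -- The second relation kills `N 0 1` and `L 2 3`; the first kills `L 0 1` and `N 2 3` and
  -- expresses the mixed block of `L` through that of `N`.
  have q00 := q 0 0; have q22 := q 2 2
  have p00 := p 0 0; have p01 := p 0 1; have p02 := p 0 2; have p03 := p 0 3; have p12 := p 1 2
  have p13 := p 1 3; have p22 := p 2 2; have p23 := p 2 3; have p33 := p 3 3; have p11 := p 1 1
  simp [minkMatrix, mink, timeForm, spaceForm, hN 0 1, hN 2 3, l0, hL 0 1, hL 2 3]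
    at p00 p01 p02 p03 p12 p13 p11 p22 p23 p33 q00 q22
  have a : N 0 1 = 0 := by linarith
  have b : N 2 3 = 0 := by linarith
  refine ⟨a, b, ?_⟩
  ext i j
  fin_cases i <;> fin_cases j <;>
    simp [starMatrix, l0, hL 0 1, hL 0 2, hL 0 3, hL 1 2, hL 1 3, hL 2 3, a, b] <;> linarith

/-- The equivalence at a point, in an adapted frame. -/
theorem CKYAt_iff_adapted {N L : Fin 4 → Matrix (Fin 4) (Fin 4) ℝ}
    (hN : ∀ k i j, N k j i = -N k i j) (hL : ∀ k i j, L k j i = -L k i j)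
    (h1 : ∀ k, N k * minkMatrix * spaceForm + timeForm * minkMatrix * L k = 0)
    (h2 : ∀ k, N k * minkMatrix * timeForm + timeForm * minkMatrix * N k
      - (L k * minkMatrix * spaceForm + spaceForm * minkMatrix * L k) = 0)
    (f h : Fin 4 → ℝ) {a b c d : ℝ} (hab : a ^ 2 + b ^ 2 ≠ 0) (hcd : c ^ 2 + d ^ 2 ≠ 0) :
    CKYAt minkMatrix (fun k => a • (N k + f k • timeForm + h k • spaceForm)
        + b • (L k + f k • spaceForm - h k • timeForm)) ↔
      MaxwellAt minkMatrix (fun k => c • (N k - (2 * f k) • timeForm - (2 * h k) • spaceForm)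
        + d • (L k - (2 * f k) • spaceForm + (2 * h k) • timeForm)) ∧
      UmbilicalAt minkMatrix spaceForm L ∧ UmbilicalAt minkMatrix timeForm N := by
  have key := fun k => mixed_of_constraints (hN k) (hL k) (h1 k) (h2 k)
  have n01 := fun k => (key k).1
  have n23 := fun k => (key k).2.1
  have l := fun k => (key k).2.2
  have add : ∀ (A B : Matrix (Fin 4) (Fin 4) ℝ), starMatrix (A + B) = starMatrix A + starMatrix B :=
    fun A B => by
      ext i j; fin_cases i <;> fin_cases j <;> simp [starMatrix] <;> ring
  have smul : ∀ (r : ℝ) (A : Matrix (Fin 4) (Fin 4) ℝ), starMatrix (r • A) = r • starMatrix A :=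
    fun r A => by
      ext i j; fin_cases i <;> fin_cases j <;> simp [starMatrix]
  have tskew : ∀ i j, timeForm j i = -timeForm i j := fun i j => by
    fin_cases i <;> fin_cases j <;> simp [timeForm]
  have sskew : ∀ i j, spaceForm j i = -spaceForm i j := fun i j => by
    fin_cases i <;> fin_cases j <;> simp [spaceForm]
  have hX : ∀ (f h : Fin 4 → ℝ) k i j, (N k + f k • timeForm + h k • spaceForm) j i =
      -(N k + f k • timeForm + h k • spaceForm) i j := fun f h k i j => by
    simp only [Matrix.add_apply, Matrix.smul_apply, smul_eq_mul, hN k i j, tskew i j, sskew i j]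
    ring
  have e1 : (fun k => a • (N k + f k • timeForm + h k • spaceForm)
        + b • (L k + f k • spaceForm - h k • timeForm)) = fun k =>
      a • (N k + f k • timeForm + h k • spaceForm)
        + b • starMatrix (N k + f k • timeForm + h k • spaceForm) := by
    funext k
    rw [add, add, smul, smul, starMatrix_timeForm, starMatrix_spaceForm, ← l k, smul_neg,
      ← sub_eq_add_neg (L k + _)]
  have e2 : (fun k => c • (N k - (2 * f k) • timeForm - (2 * h k) • spaceForm)
        + d • (L k - (2 * f k) • spaceForm + (2 * h k) • timeForm)) = fun k =>
      c • (N k + (-2 * f k) • timeForm + (-2 * h k) • spaceForm)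
        + d • starMatrix (N k + (-2 * f k) • timeForm + (-2 * h k) • spaceForm) := by
    funext k
    rw [add, add, smul, smul, starMatrix_timeForm, starMatrix_spaceForm, ← l k]
    module
  rw [e1, e2, rotation_iff (P := CKYAt minkMatrix) (fun T => CKYAt.star)
      (fun S T hS hT => hS.comb hT) (hX f h) hab,
    rotation_iff (P := MaxwellAt minkMatrix) (fun T => MaxwellAt.star)
      (fun S T hS hT => hS.comb hT)
      (hX (fun k => -2 * f k) (fun k => -2 * h k)) hcd,
    CKYAt_minkMatrix_iff (hX f h),
    MaxwellAt_minkMatrix_iff (hX (fun k => -2 * f k) (fun k => -2 * h k)),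
    UmbilicalAt_timeForm_iff hN n23,
    UmbilicalAt_spaceForm_iff hL (fun k => by simp [l k, starMatrix, n23 k])]
  simp only [l]
  simp [starMatrix, timeForm, spaceForm, n01, n23, hN _ 0 1, hN _ 0 2, hN _ 0 3, hN _ 1 2, hN _ 1 3,
    hN _ 2 3]
  -- Typical pairs on the left are `N 2 0 2 = N 3 0 3 = -f 1` and `N 2 0 3 = -N 3 0 2 = h 0`. The
  -- difference in the first and the sum in the second are umbilical equations; the complementary
  -- combinations `N 2 0 2 + N 3 0 3 = -2 * f 1` and `N 2 0 3 - N 3 0 2 = 2 * h 0` are Maxwell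
  -- equations.
  constructor
  · rintro ⟨⟨a1, a2, a3, a4, a5, a6, a7, a8⟩, b1, b2, b3, b4, b5, b6, b7, b8⟩
    refine ⟨⟨⟨?_, ?_, ?_, ?_⟩, ?_, ?_, ?_, ?_⟩, ⟨?_, ?_, ?_, ?_⟩, ?_, ?_, ?_, ?_⟩ <;> linarith
  · rintro ⟨⟨⟨a1, a2, a3, a4⟩, a5, a6, a7, a8⟩, ⟨b1, b2, b3, b4⟩, b5, b6, b7, b8⟩
    refine ⟨⟨?_, ?_, ?_, ?_, ?_, ?_, ?_, ?_⟩, ?_, ?_, ?_, ?_, ?_, ?_, ?_, ?_⟩ <;> linarith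

/-! ### Change of frame -/

/-- The value of a 3-index array on three vectors. -/
def contract (x y z : Fin 4 → ℝ) (f : Fin 4 → Fin 4 → Fin 4 → ℝ) : ℝ :=
  ∑ k, ∑ i, ∑ j, x k * y i * z j * f k i j

/-- The components of a 3-index array in the frame given by the rows of `D`. -/
def changeFrame (D : Matrix (Fin 4) (Fin 4) ℝ) (T : Fin 4 → Matrix (Fin 4) (Fin 4) ℝ) :
    Fin 4 → Matrix (Fin 4) (Fin 4) ℝ :=
  fun a => Matrix.of fun b c => contract (D a) (D b) (D c) fun k i j => T k i j

theorem contract_comb (x y z : Fin 4 → ℝ) (f g : Fin 4 → Fin 4 → Fin 4 → ℝ) (a b : ℝ) :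
    contract x y z (fun k i j => a * f k i j + b * g k i j) =
      a * contract x y z f + b * contract x y z g := by
  simp only [contract, Finset.mul_sum, ← Finset.sum_add_distrib]
  refine Finset.sum_congr rfl fun k _ => Finset.sum_congr rfl fun i _ =>
    Finset.sum_congr rfl fun j _ => by ring

theorem contract_swap (x y z : Fin 4 → ℝ) (f : Fin 4 → Fin 4 → Fin 4 → ℝ) :
    contract x y z (fun k i j => f i k j) = contract y x z f := by
  simp only [contract]
  rw [Finset.sum_comm]
  refine Finset.sum_congr rfl fun k _ => Finset.sum_congr rfl fun i _ =>
    Finset.sum_congr rfl fun j _ => by ring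

theorem contract_swap_right (x y z : Fin 4 → ℝ) (f : Fin 4 → Fin 4 → Fin 4 → ℝ) :
    contract x y z (fun k i j => f k j i) = contract x z y f := by
  simp only [contract]
  refine Finset.sum_congr rfl fun k _ => ?_
  rw [Finset.sum_comm]
  refine Finset.sum_congr rfl fun i _ => Finset.sum_congr rfl fun j _ => by ring

theorem contract_eq_nested (x y z : Fin 4 → ℝ) (f : Fin 4 → Fin 4 → Fin 4 → ℝ) :
    contract x y z f = ∑ k, x k * ∑ i, y i * ∑ j, z j * f k i j := by
  simp only [contract, Finset.mul_sum, mul_assoc]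

theorem contract_outer (x y z : Fin 4 → ℝ) (G : Matrix (Fin 4) (Fin 4) ℝ) (a : Fin 4 → ℝ) :
    contract x y z (fun k i j => G k i * a j) = (x ⬝ᵥ G.mulVec y) * (z ⬝ᵥ a) := by
  rw [contract_eq_nested, dotProduct, Finset.sum_mul]
  refine Finset.sum_congr rfl fun k _ => ?_
  rw [mul_assoc]
  congr 1
  rw [Matrix.mulVec, dotProduct, Finset.sum_mul]
  refine Finset.sum_congr rfl fun i _ => ?_
  rw [dotProduct, Finset.mul_sum, Finset.mul_sum]
  exact Finset.sum_congr rfl fun j _ => by ring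

theorem contract_outer' (x y z : Fin 4 → ℝ) (G : Matrix (Fin 4) (Fin 4) ℝ) (a : Fin 4 → ℝ) :
    contract x y z (fun k i j => a k * G i j) = (x ⬝ᵥ a) * (y ⬝ᵥ G.mulVec z) := by
  rw [contract_eq_nested, dotProduct, Finset.sum_mul]
  refine Finset.sum_congr rfl fun k _ => ?_
  rw [mul_assoc]
  congr 1
  rw [dotProduct, Finset.mul_sum]
  refine Finset.sum_congr rfl fun i _ => ?_
  rw [Matrix.mulVec, dotProduct, Finset.mul_sum, Finset.mul_sum, Finset.mul_sum]
  exact Finset.sum_congr rfl fun j _ => by ring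

theorem contract_changeFrame (D : Matrix (Fin 4) (Fin 4) ℝ)
    (T : Fin 4 → Matrix (Fin 4) (Fin 4) ℝ) (x y z : Fin 4 → ℝ) :
    contract x y z (fun a b c => changeFrame D T a b c) =
      contract (Matrix.vecMul x D) (Matrix.vecMul y D) (Matrix.vecMul z D)
        (fun k i j => T k i j) := by
  have sw : ∀ (x : Fin 4 → ℝ) (h : Fin 4 → ℝ), ∑ k, Matrix.vecMul x D k * h k =
      ∑ a, x a * ∑ k, D a k * h k := fun x h => by
    simp only [Matrix.vecMul, dotProduct, Finset.sum_mul, Finset.mul_sum, mul_assoc]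
    rw [Finset.sum_comm]
  rw [contract_eq_nested, contract_eq_nested, sw]
  refine Finset.sum_congr rfl fun a _ => ?_
  congr 1
  simp_rw [sw, changeFrame, Matrix.of_apply, contract_eq_nested, Finset.mul_sum]
  have c3 : ∀ g : Fin 4 → Fin 4 → Fin 4 → ℝ, ∑ b, ∑ c, ∑ k, g b c k = ∑ k, ∑ b, ∑ c, g b c k :=
    fun g => by
      rw [Finset.sum_comm (f := fun k b => ∑ c, g b c k)]
      exact Finset.sum_congr rfl fun b _ => Finset.sum_comm
  rw [c3]
  refine Finset.sum_congr rfl fun k _ => ?_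
  refine Finset.sum_congr rfl fun b _ => ?_
  rw [Finset.sum_comm]
  refine Finset.sum_congr rfl fun i _ => ?_
  refine Finset.sum_congr rfl fun c _ => ?_
  refine Finset.sum_congr rfl fun j _ => by ring

theorem changeFrame_changeFrame (E D : Matrix (Fin 4) (Fin 4) ℝ)
    (T : Fin 4 → Matrix (Fin 4) (Fin 4) ℝ) :
    changeFrame E (changeFrame D T) = changeFrame (E * D) T := by
  funext a
  ext b c
  exact contract_changeFrame D T (E a) (E b) (E c)

theorem changeFrame_apply (D : Matrix (Fin 4) (Fin 4) ℝ)
    (T : Fin 4 → Matrix (Fin 4) (Fin 4) ℝ) (a : Fin 4) :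
    changeFrame D T a = ∑ k, D a k • (D * T k * D.transpose) := by
  ext b c
  simp only [changeFrame, Matrix.of_apply, contract, Matrix.sum_apply, Matrix.smul_apply,
    Matrix.mul_apply, Matrix.transpose_apply, smul_eq_mul, Finset.mul_sum, Finset.sum_mul]
  refine Finset.sum_congr rfl fun k _ => ?_
  rw [Finset.sum_comm]
  refine Finset.sum_congr rfl fun i _ => Finset.sum_congr rfl fun j _ => by ring

theorem changeFrame_one (T : Fin 4 → Matrix (Fin 4) (Fin 4) ℝ) : changeFrame 1 T = T := by
  funext a
  rw [changeFrame_apply]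
  simp [Matrix.one_apply]

theorem mul_mul_transpose_apply (D G : Matrix (Fin 4) (Fin 4) ℝ) (a b : Fin 4) :
    (D * G * D.transpose) a b = D a ⬝ᵥ G.mulVec (D b) := by
  simp only [Matrix.mul_apply, Matrix.transpose_apply, dotProduct, Matrix.mulVec, Finset.mul_sum,
    Finset.sum_mul]
  rw [Finset.sum_comm]
  refine Finset.sum_congr rfl fun i _ => Finset.sum_congr rfl fun k _ => by ring

/-- For each value of the free index the trace is that of a matrix product `G⁻¹ * S`; under
congruence by `D` the factors of `D` cancel cyclically, and only the free index is transformed. -/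
theorem trace₃_changeFrame {G D : Matrix (Fin 4) (Fin 4) ℝ} (hD : IsUnit D.det)
    (T : Fin 4 → Matrix (Fin 4) (Fin 4) ℝ) (c : Fin 4) :
    trace₃ (D * G * D.transpose) (changeFrame D T) c = D c ⬝ᵥ trace₃ G T := by
  have tr : ∀ (H : Matrix (Fin 4) (Fin 4) ℝ) (S : Fin 4 → Matrix (Fin 4) (Fin 4) ℝ) (j : Fin 4),
      trace₃ H S j = (H⁻¹ * Matrix.of fun i k => S k i j).trace := fun H S j => by
    simp [trace₃, Matrix.trace, Matrix.mul_apply]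
  have sl : (Matrix.of fun b a => changeFrame D T a b c) =
      ∑ j, D c j • (D * (Matrix.of fun i k => T k i j) * D.transpose) := by
    ext b a
    rw [Matrix.of_apply, changeFrame, Matrix.of_apply,
      ← contract_swap (D b) (D a) (D c) (fun k i j => T k i j),
      ← contract_swap_right (D b) (D c) (D a) (fun i k j => T k i j),
      ← contract_swap (D c) (D b) (D a) (fun i j k => T k i j),
      contract_eq_nested, Matrix.sum_apply]
    refine Finset.sum_congr rfl fun j _ => ?_
    rw [Matrix.smul_apply, smul_eq_mul, mul_mul_transpose_apply]
    simp only [dotProduct, Matrix.mulVec, Matrix.of_apply, mul_comm]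
  have hDT : IsUnit D.transpose.det := by rwa [Matrix.det_transpose]
  rw [tr, sl, Finset.mul_sum, Matrix.trace_sum, dotProduct]
  refine Finset.sum_congr rfl fun j _ => ?_
  rw [tr, Matrix.mul_smul, Matrix.trace_smul, smul_eq_mul, Matrix.mul_inv_rev, Matrix.mul_inv_rev]
  congr 1
  calc _ = (D.transpose⁻¹ * (G⁻¹ * (D⁻¹ * D) * (Matrix.of fun i k => T k i j)
        * D.transpose)).trace := by simp only [Matrix.mul_assoc]
    _ = _ := by
      rw [Matrix.trace_mul_comm, Matrix.nonsing_inv_mul _ hD, Matrix.mul_one, Matrix.mul_assoc,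
        Matrix.mul_nonsing_inv _ hDT, Matrix.mul_one]

theorem CKYAt.changeFrame {G D : Matrix (Fin 4) (Fin 4) ℝ} (hD : IsUnit D.det)
    {T : Fin 4 → Matrix (Fin 4) (Fin 4) ℝ} (h : CKYAt G T) :
    CKYAt (D * G * D.transpose) (changeFrame D T) := by
  intro a b c
  simp only [trace₃_changeFrame hD, mul_mul_transpose_apply]
  -- The equation is rewritten as nested two-term combinations so that `contract_comb` can evaluate
  -- both sides on three rows of `D`.
  have e : (fun k i j => 1 / 2 * T k i j + 1 / 2 * T i k j) = fun k i j =>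
      1 * ((1 / 3) * (G k i * trace₃ G T j) + (-1 / 6) * (trace₃ G T k * G i j))
        + (-1 / 6) * (trace₃ G T i * G k j) := by
    funext k i j
    linear_combination h k i j
  have e' := congrArg (contract (D a) (D b) (D c)) e
  rw [contract_comb _ _ _ (fun k i j => T k i j) (fun k i j => T i k j),
    contract_comb _ _ _ (fun k i j => (1 / 3) * (G k i * trace₃ G T j)
      + (-1 / 6) * (trace₃ G T k * G i j)) (fun k i j => trace₃ G T i * G k j),
    contract_comb _ _ _ (fun k i j => G k i * trace₃ G T j) (fun k i j => trace₃ G T k * G i j),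
    contract_swap _ _ _ (fun k i j => T k i j),
    contract_swap _ _ _ (fun k i j => trace₃ G T k * G i j), contract_outer, contract_outer',
    contract_outer'] at e'
  simp only [Spacetime.changeFrame, Matrix.of_apply]
  linear_combination e'

theorem MaxwellAt.changeFrame {G D : Matrix (Fin 4) (Fin 4) ℝ} (hD : IsUnit D.det)
    {T : Fin 4 → Matrix (Fin 4) (Fin 4) ℝ} (h : MaxwellAt G T) :
    MaxwellAt (D * G * D.transpose) (changeFrame D T) := by
  refine ⟨fun j => ?_, fun a b c => ?_⟩
  · rw [trace₃_changeFrame hD, show trace₃ G T = 0 from funext h.1, dotProduct_zero]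
  · have e : (fun k i j => 1 * (1 * T k i j + 1 * T i j k) + 1 * T j k i) = fun k i j =>
        0 * T k i j + 0 * T k i j := by
      funext k i j
      linear_combination h.2 k i j
    have e' := congrArg (contract (D a) (D b) (D c)) e
    rw [contract_comb _ _ _ (fun k i j => 1 * T k i j + 1 * T i j k) (fun k i j => T j k i),
      contract_comb _ _ _ (fun k i j => T k i j) (fun k i j => T i j k),
      contract_comb _ _ _ (fun k i j => T k i j) (fun k i j => T k i j),
      contract_swap _ _ _ (fun k i j => T k j i),
      contract_swap_right _ _ _ (fun k i j => T k i j),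
      contract_swap_right _ _ _ (fun k i j => T i k j),
      contract_swap _ _ _ (fun k i j => T k i j)] at e'
    simp only [Spacetime.changeFrame, Matrix.of_apply]
    linear_combination e'

/-- Replacing the free index by an arbitrary vector `v` makes every term a full contraction, whose
behaviour under a change of frame is known. -/
theorem umbilicalAt_iff_contract {G B : Matrix (Fin 4) (Fin 4) ℝ}
    {N : Fin 4 → Matrix (Fin 4) (Fin 4) ℝ} :
    UmbilicalAt G B N ↔ ∃ Z : Fin 4 → ℝ, ∀ X Y : Fin 4 → ℝ, B.mulVec X = 0 → B.mulVec Y = 0 →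
      ∀ v : Fin 4 → ℝ, contract X v Y (fun k i j => N k i j) + contract Y v X (fun k i j => N k i j)
        + 2 * (X ⬝ᵥ G.mulVec Y) * (v ⬝ᵥ B.mulVec Z) = 0 := by
  have key : ∀ Z X Y v : Fin 4 → ℝ, contract X v Y (fun k i j => N k i j)
      + contract Y v X (fun k i j => N k i j) + 2 * (X ⬝ᵥ G.mulVec Y) * (v ⬝ᵥ B.mulVec Z) =
      ∑ i, v i * ((∑ k, ∑ j, (X k * Y j + Y k * X j) * N k i j)
      + 2 * (∑ k, ∑ j, X k * Y j * G k j) * (B.mulVec Z) i) := fun Z X Y v => by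
    have g : X ⬝ᵥ G.mulVec Y = ∑ k, ∑ j, X k * Y j * G k j := by
      simp only [dotProduct, Matrix.mulVec, Finset.mul_sum]
      refine Finset.sum_congr rfl fun i _ => Finset.sum_congr rfl fun k _ => by ring
    have c : ∀ X Y, contract X v Y (fun k i j => N k i j) =
        ∑ i, v i * ∑ k, ∑ j, X k * Y j * N k i j := fun X Y => by
      simp only [contract, Finset.mul_sum]
      rw [Finset.sum_comm]
      refine Finset.sum_congr rfl fun i _ => Finset.sum_congr rfl fun k _ =>
        Finset.sum_congr rfl fun j _ => by ring
    rw [c, c, g]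
    simp only [mul_add, add_mul, Finset.sum_add_distrib]
    congr 1
    rw [dotProduct, Finset.mul_sum]
    exact Finset.sum_congr rfl fun i _ => by ring
  refine exists_congr fun Z => forall_congr' fun X => forall_congr' fun Y =>
    imp_congr_right fun _ => imp_congr_right fun _ => ⟨fun h v => ?_, fun h i => ?_⟩
  · rw [key]
    simp [h]
  · have := h (Pi.single i 1)
    rw [key] at this
    simpa [Pi.single_apply] using this

theorem UmbilicalAt.changeFrame {G B D : Matrix (Fin 4) (Fin 4) ℝ} (hD : IsUnit D.det)
    {N : Fin 4 → Matrix (Fin 4) (Fin 4) ℝ} (h : UmbilicalAt G B N) :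
    UmbilicalAt (D * G * D.transpose) (D * B * D.transpose) (changeFrame D N) := by
  rw [umbilicalAt_iff_contract] at h ⊢
  obtain ⟨Z, hZ⟩ := h
  have hDT : IsUnit D.transpose.det := by rwa [Matrix.det_transpose]
  have ker : ∀ X : Fin 4 → ℝ, (D * B * D.transpose).mulVec X = 0 →
      B.mulVec (Matrix.vecMul X D) = 0 := fun X hX => by
    have := congrArg (D⁻¹).mulVec hX
    rwa [Matrix.mulVec_mulVec, Matrix.mul_assoc, ← Matrix.mul_assoc, Matrix.nonsing_inv_mul _ hD,
      Matrix.one_mul, ← Matrix.mulVec_mulVec, Matrix.mulVec_transpose, Matrix.mulVec_zero] at this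
  have quad : ∀ (H : Matrix (Fin 4) (Fin 4) ℝ) (X Y : Fin 4 → ℝ),
      X ⬝ᵥ (D * H * D.transpose).mulVec Y =
      Matrix.vecMul X D ⬝ᵥ H.mulVec (Matrix.vecMul Y D) := fun H X Y => by
    rw [← Matrix.mulVec_mulVec, ← Matrix.mulVec_mulVec, Matrix.dotProduct_mulVec,
      Matrix.mulVec_transpose]
  -- The frame vectors are the rows of `D`, so the components of a vector transform by the inverse
  -- transpose.
  refine ⟨(D.transpose⁻¹).mulVec Z, fun X Y hX hY v => ?_⟩
  have hz : Matrix.vecMul ((D.transpose⁻¹).mulVec Z) D = Z := by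
    rw [← Matrix.mulVec_transpose, Matrix.mulVec_mulVec, Matrix.mul_nonsing_inv _ hDT,
      Matrix.one_mulVec]
  rw [contract_changeFrame, contract_changeFrame, quad, quad, hz]
  exact hZ _ _ (ker X hX) (ker Y hY) _

theorem changeFrame_inv_changeFrame {D : Matrix (Fin 4) (Fin 4) ℝ} (hD : IsUnit D.det)
    {T : Fin 4 → Matrix (Fin 4) (Fin 4) ℝ} :
    changeFrame D⁻¹ (changeFrame D T) = T := by
  rw [changeFrame_changeFrame, Matrix.nonsing_inv_mul _ hD, changeFrame_one]

theorem inv_mul_mul_transpose {G D : Matrix (Fin 4) (Fin 4) ℝ} (hD : IsUnit D.det) :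
    D⁻¹ * (D * G * D.transpose) * (D⁻¹).transpose = G := by
  have hDT : IsUnit D.transpose.det := by rwa [Matrix.det_transpose]
  rw [Matrix.transpose_nonsing_inv, Matrix.mul_assoc, Matrix.mul_assoc, Matrix.mul_assoc,
    Matrix.mul_nonsing_inv _ hDT, Matrix.mul_one, ← Matrix.mul_assoc, Matrix.nonsing_inv_mul _ hD,
    Matrix.one_mul]

theorem CKYAt_changeFrame_iff {G D : Matrix (Fin 4) (Fin 4) ℝ} (hD : IsUnit D.det)
    {T : Fin 4 → Matrix (Fin 4) (Fin 4) ℝ} :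
    CKYAt (D * G * D.transpose) (changeFrame D T) ↔ CKYAt G T := by
  refine ⟨fun h => ?_, fun h => h.changeFrame hD⟩
  have := h.changeFrame (Matrix.isUnit_nonsing_inv_det D hD)
  rwa [inv_mul_mul_transpose hD, changeFrame_inv_changeFrame hD] at this

theorem MaxwellAt_changeFrame_iff {G D : Matrix (Fin 4) (Fin 4) ℝ} (hD : IsUnit D.det)
    {T : Fin 4 → Matrix (Fin 4) (Fin 4) ℝ} :
    MaxwellAt (D * G * D.transpose) (changeFrame D T) ↔ MaxwellAt G T := by
  refine ⟨fun h => ?_, fun h => h.changeFrame hD⟩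
  have := h.changeFrame (Matrix.isUnit_nonsing_inv_det D hD)
  rwa [inv_mul_mul_transpose hD, changeFrame_inv_changeFrame hD] at this

theorem UmbilicalAt_changeFrame_iff {G B D : Matrix (Fin 4) (Fin 4) ℝ} (hD : IsUnit D.det)
    {T : Fin 4 → Matrix (Fin 4) (Fin 4) ℝ} :
    UmbilicalAt (D * G * D.transpose) (D * B * D.transpose) (changeFrame D T) ↔
      UmbilicalAt G B T := by
  refine ⟨fun h => ?_, fun h => h.changeFrame hD⟩
  have := h.changeFrame (Matrix.isUnit_nonsing_inv_det D hD)
  rwa [inv_mul_mul_transpose hD, inv_mul_mul_transpose hD, changeFrame_inv_changeFrame hD] at this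

/-! ### Adapted frames -/

/-- The metric, the unitary form and its dual have their standard components in the frame given by
the rows of `D`. -/
structure IsAdaptedFrame (G U W D : Matrix (Fin 4) (Fin 4) ℝ) : Prop where
  metric : D * G * D.transpose = minkMatrix
  time : D * U * D.transpose = timeForm
  space : D * W * D.transpose = spaceForm

theorem isUnit_det_of_mul_mul_transpose {G D : Matrix (Fin 4) (Fin 4) ℝ}
    (h : D * G * D.transpose = minkMatrix) : IsUnit D.det ∧ IsUnit G.det := by
  have h1 : IsUnit (D * G * D.transpose).det := by
    rw [h]
    exact Matrix.isUnit_det_of_left_inverse minkMatrix_mul_self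
  rw [Matrix.det_mul, Matrix.det_mul] at h1
  exact ⟨isUnit_of_mul_isUnit_left (isUnit_of_mul_isUnit_left h1),
    isUnit_of_mul_isUnit_right (isUnit_of_mul_isUnit_left h1)⟩

theorem minkMatrix_eq {G D : Matrix (Fin 4) (Fin 4) ℝ} (h : D * G * D.transpose = minkMatrix) :
    minkMatrix = D.transpose⁻¹ * G⁻¹ * D⁻¹ := by
  rw [← minkMatrix_inv, ← h, Matrix.mul_inv_rev, Matrix.mul_inv_rev, Matrix.mul_assoc]

theorem mul_minkMatrix_mul {G D : Matrix (Fin 4) (Fin 4) ℝ}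
    (h : D * G * D.transpose = minkMatrix) (A B : Matrix (Fin 4) (Fin 4) ℝ) :
    (D * A * D.transpose) * minkMatrix * (D * B * D.transpose) =
      D * (A * G⁻¹ * B) * D.transpose := by
  have hu := (isUnit_det_of_mul_mul_transpose h).1
  have huT : IsUnit D.transpose.det := by rwa [Matrix.det_transpose]
  rw [minkMatrix_eq h]
  calc _ = D * A * (D.transpose * D.transpose⁻¹) * G⁻¹ * (D⁻¹ * D) * B * D.transpose := by
        simp only [Matrix.mul_assoc]
    _ = _ := by
        rw [Matrix.mul_nonsing_inv _ huT, Matrix.nonsing_inv_mul _ hu]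
        simp only [Matrix.mul_assoc, Matrix.mul_one]

theorem IsAdaptedFrame.isUnit_det {G U W D : Matrix (Fin 4) (Fin 4) ℝ}
    (h : IsAdaptedFrame G U W D) : IsUnit D.det :=
  (isUnit_det_of_mul_mul_transpose h.metric).1

/-- The algebraic relations between the metric `G`, a unitary 2-form `U` and its dual `W`. -/
structure IsDualPair (G U W : Matrix (Fin 4) (Fin 4) ℝ) : Prop where
  symm : G.transpose = G
  unit : IsUnit G.det
  skew : U.transpose = -U
  skew_dual : W.transpose = -W
  mul_dual : U * G⁻¹ * W = 0
  sub_eq : U * G⁻¹ * U - W * G⁻¹ * W = G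

theorem IsDualPair.dual_mul {G U W : Matrix (Fin 4) (Fin 4) ℝ} (h : IsDualPair G U W) :
    W * G⁻¹ * U = 0 := by
  have := congrArg Matrix.transpose h.mul_dual
  simpa [Matrix.transpose_mul, Matrix.transpose_nonsing_inv, h.symm, h.skew, h.skew_dual,
    Matrix.mul_assoc] using this

/-- The frame is `u, w, h, h'`, with `h` a unit vector orthogonal to `u` and `w`, and `h'` the image
of `h` under `G⁻¹ * W`. The relations of a dual pair are unchanged under `W ↦ -W`; defining `h'`
through `W` absorbs this sign, so no orientation enters. -/
theorem exists_isAdaptedFrame {G U W : Matrix (Fin 4) (Fin 4) ℝ} (hP : IsDualPair G U W)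
    {u w : Fin 4 → ℝ} (huu : u ⬝ᵥ G.mulVec u = -1) (hww : w ⬝ᵥ G.mulVec w = 1)
    (huw : u ⬝ᵥ G.mulVec w = 0)
    (hU : U = Matrix.vecMulVec (G.mulVec u) (G.mulVec w) - Matrix.vecMulVec (G.mulVec w) (G.mulVec u))
    (hpos : ∀ h : Fin 4 → ℝ, u ⬝ᵥ G.mulVec h = 0 → h ≠ 0 → 0 < h ⬝ᵥ G.mulVec h) :
    ∃ D, IsAdaptedFrame G U W D := by
  have sy : ∀ x y : Fin 4 → ℝ, x ⬝ᵥ G.mulVec y = y ⬝ᵥ G.mulVec x := fun x y => by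
    rw [Matrix.dotProduct_mulVec, ← Matrix.mulVec_transpose, hP.symm, dotProduct_comm]
  have sk : ∀ x y : Fin 4 → ℝ, x ⬝ᵥ W.mulVec y = -(y ⬝ᵥ W.mulVec x) := fun x y => by
    rw [Matrix.dotProduct_mulVec, ← Matrix.mulVec_transpose, hP.skew_dual, dotProduct_comm,
      Matrix.neg_mulVec, dotProduct_neg]
  have hwu : w ⬝ᵥ G.mulVec u = 0 := by rw [sy, huw]
  have Ux : ∀ x, U.mulVec x = (w ⬝ᵥ G.mulVec x) • G.mulVec u - (u ⬝ᵥ G.mulVec x) • G.mulVec w :=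
    fun x => by
      rw [hU, Matrix.sub_mulVec, Matrix.vecMulVec_mulVec, Matrix.vecMulVec_mulVec,
        dotProduct_comm (G.mulVec w), dotProduct_comm (G.mulVec u), sy, sy u x]
      simp
  have Uu : U.mulVec u = G.mulVec w := by rw [Ux, hwu, huu]; simp
  have Uw : U.mulVec w = G.mulVec u := by rw [Ux, hww, huw]; simp
  have ginv : ∀ x, (G⁻¹).mulVec (G.mulVec x) = x := fun x => by
    rw [Matrix.mulVec_mulVec, Matrix.nonsing_inv_mul _ hP.unit, Matrix.one_mulVec]
  have ginv' : ∀ x, G.mulVec ((G⁻¹).mulVec x) = x := fun x => by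
    rw [Matrix.mulVec_mulVec, Matrix.mul_nonsing_inv _ hP.unit, Matrix.one_mulVec]
  have Wu : W.mulVec u = 0 := by
    rw [← ginv u, ← Uw, Matrix.mulVec_mulVec, Matrix.mulVec_mulVec, hP.dual_mul,
      Matrix.zero_mulVec]
  have Ww : W.mulVec w = 0 := by
    rw [← ginv w, ← Uu, Matrix.mulVec_mulVec, Matrix.mulVec_mulVec, hP.dual_mul,
      Matrix.zero_mulVec]
  -- Two homogeneous linear equations in four unknowns have a nonzero solution.
  obtain ⟨h₀, h₀0, hu₀, hw₀⟩ : ∃ h₀ : Fin 4 → ℝ, h₀ ≠ 0 ∧ u ⬝ᵥ G.mulVec h₀ = 0 ∧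
      w ⬝ᵥ G.mulVec h₀ = 0 := by
    let A : Matrix (Fin 2) (Fin 4) ℝ := Matrix.of ![Matrix.vecMul u G, Matrix.vecMul w G]
    obtain ⟨v, hv, hv0⟩ := (Submodule.ne_bot_iff _).1
      (LinearMap.ker_ne_bot_of_finrank_lt (f := A.mulVecLin) (by simp))
    refine ⟨v, hv0, ?_, ?_⟩
    · rw [Matrix.dotProduct_mulVec]; exact congrFun hv 0
    · rw [Matrix.dotProduct_mulVec]; exact congrFun hv 1
  have hp := hpos h₀ hu₀ h₀0
  obtain ⟨h, huh, hwh, hhh⟩ : ∃ h : Fin 4 → ℝ, u ⬝ᵥ G.mulVec h = 0 ∧ w ⬝ᵥ G.mulVec h = 0 ∧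
      h ⬝ᵥ G.mulVec h = 1 := by
    refine ⟨(Real.sqrt (h₀ ⬝ᵥ G.mulVec h₀))⁻¹ • h₀, ?_, ?_, ?_⟩
    · simp [Matrix.mulVec_smul, hu₀]
    · simp [Matrix.mulVec_smul, hw₀]
    · simp only [Matrix.mulVec_smul, dotProduct_smul, smul_dotProduct, smul_eq_mul]
      rw [← mul_assoc, ← mul_inv, Real.mul_self_sqrt hp.le, inv_mul_cancel₀ hp.ne']
  have Uh : U.mulVec h = 0 := by rw [Ux, hwh, huh]; simp
  set h' := (G⁻¹).mulVec (W.mulVec h) with hh'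
  have Gh' : G.mulVec h' = W.mulVec h := ginv' _
  have Uh' : U.mulVec h' = 0 := by
    rw [hh', Matrix.mulVec_mulVec, Matrix.mulVec_mulVec, hP.mul_dual, Matrix.zero_mulVec]
  -- On the kernel of `U` the relation `U * G⁻¹ * U - W * G⁻¹ * W = G` says that `G⁻¹ * W` squares
  -- to `-1`.
  have Wh' : W.mulVec h' = -G.mulVec h := by
    have := congrArg (fun A => Matrix.mulVec A h) hP.sub_eq
    simp only [Matrix.sub_mulVec, ← Matrix.mulVec_mulVec, Uh, Matrix.mulVec_zero, zero_sub] at this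
    rw [hh', ← this, neg_neg]
  have hhh' : h ⬝ᵥ G.mulVec h' = 0 := by rw [Gh']; linarith [sk h h]
  have huh' : u ⬝ᵥ G.mulVec h' = 0 := by rw [Gh', sk, Wu]; simp
  have hwh' : w ⬝ᵥ G.mulVec h' = 0 := by rw [Gh', sk, Ww]; simp
  have hh'h' : h' ⬝ᵥ G.mulVec h' = 1 := by rw [Gh', sk, Wh']; simp [hhh]
  have hhu : h ⬝ᵥ G.mulVec u = 0 := by rw [sy, huh]
  have hhw : h ⬝ᵥ G.mulVec w = 0 := by rw [sy, hwh]
  have hh'u : h' ⬝ᵥ G.mulVec u = 0 := by rw [sy, huh']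
  have hh'w : h' ⬝ᵥ G.mulVec w = 0 := by rw [sy, hwh']
  have hh'h : h' ⬝ᵥ G.mulVec h = 0 := by rw [sy, hhh']
  have row : ∀ a, (Matrix.of ![u, w, h, h']) a = ![u, w, h, h'] a := fun _ => rfl
  refine ⟨Matrix.of ![u, w, h, h'], ?_, ?_, ?_⟩
  · ext a b
    rw [mul_mul_transpose_apply, row, row]
    fin_cases a <;> fin_cases b <;> simp [minkMatrix, mink, huu, huw, huh, huh', hwu, hww, hwh, hwh', hhu, hhw, hhh,
      hhh', hh'u, hh'w, hh'h, hh'h']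
  · ext a b
    rw [mul_mul_transpose_apply, row, row]
    fin_cases a <;> fin_cases b <;> simp [timeForm, Uu, Uw, Uh, Uh', huu, huw, hwu, hww, hhu, hhw, hh'u, hh'w]
  · ext a b
    rw [mul_mul_transpose_apply, row, row]
    fin_cases a <;> fin_cases b <;> simp [spaceForm, Wu, Ww, Wh', ← Gh', huh, huh', hwh, hwh', hhh,
      hhh', hh'h, hh'h']

/-- The equivalence at a point. -/
theorem CKYAt_iff {G U W D : Matrix (Fin 4) (Fin 4) ℝ} (hD : IsAdaptedFrame G U W D)
    {N L : Fin 4 → Matrix (Fin 4) (Fin 4) ℝ}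
    (hN : ∀ k, (N k).transpose = -N k) (hL : ∀ k, (L k).transpose = -L k)
    (h1 : ∀ k, N k * G⁻¹ * W + U * G⁻¹ * L k = 0)
    (h2 : ∀ k, N k * G⁻¹ * U + U * G⁻¹ * N k - (L k * G⁻¹ * W + W * G⁻¹ * L k) = 0)
    (f h : Fin 4 → ℝ) {a b c d : ℝ} (hab : a ^ 2 + b ^ 2 ≠ 0) (hcd : c ^ 2 + d ^ 2 ≠ 0) :
    CKYAt G (fun k => a • (N k + f k • U + h k • W) + b • (L k + f k • W - h k • U)) ↔
      MaxwellAt G (fun k => c • (N k - (2 * f k) • U - (2 * h k) • W)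
        + d • (L k - (2 * f k) • W + (2 * h k) • U)) ∧
      UmbilicalAt G W L ∧ UmbilicalAt G U N := by
  have hu := hD.isUnit_det
  have skew : ∀ N : Fin 4 → Matrix (Fin 4) (Fin 4) ℝ, (∀ k, (N k).transpose = -N k) →
      ∀ k i j, changeFrame D N k j i = -changeFrame D N k i j := fun N hN k i j => by
    have : (changeFrame D N k).transpose = -changeFrame D N k := by
      rw [changeFrame_apply, Matrix.transpose_sum, ← Finset.sum_neg_distrib]
      refine Finset.sum_congr rfl fun l _ => ?_
      rw [Matrix.transpose_smul, Matrix.transpose_mul, Matrix.transpose_mul, hN,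
        Matrix.transpose_transpose, Matrix.neg_mul, Matrix.mul_neg, smul_neg, Matrix.mul_assoc]
    exact congrFun (congrFun this i) j
  have prod := fun A B => mul_minkMatrix_mul hD.metric A B
  have left : ∀ (N : Fin 4 → Matrix (Fin 4) (Fin 4) ℝ) (B : Matrix (Fin 4) (Fin 4) ℝ) (k : Fin 4),
      changeFrame D N k * minkMatrix * (D * B * D.transpose) =
        ∑ l, D k l • (D * (N l * G⁻¹ * B) * D.transpose) := fun N B k => by
    rw [changeFrame_apply, Finset.sum_mul, Finset.sum_mul]
    refine Finset.sum_congr rfl fun l _ => ?_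
    rw [Matrix.smul_mul, Matrix.smul_mul, prod]
  have right : ∀ (N : Fin 4 → Matrix (Fin 4) (Fin 4) ℝ) (B : Matrix (Fin 4) (Fin 4) ℝ) (k : Fin 4),
      (D * B * D.transpose) * minkMatrix * changeFrame D N k =
        ∑ l, D k l • (D * (B * G⁻¹ * N l) * D.transpose) := fun N B k => by
    rw [changeFrame_apply, Finset.mul_sum]
    refine Finset.sum_congr rfl fun l _ => ?_
    rw [Matrix.mul_smul, prod]
  -- The derivatives `f` and `h` are covectors, so in the new frame they become `D.mulVec f` and
  -- `D.mulVec h`.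
  have e1 : changeFrame D
      (fun k => a • (N k + f k • U + h k • W) + b • (L k + f k • W - h k • U)) =
      fun k => a • (changeFrame D N k + (D.mulVec f) k • timeForm + (D.mulVec h) k • spaceForm)
        + b • (changeFrame D L k + (D.mulVec f) k • spaceForm - (D.mulVec h) k • timeForm) := by
    rw [← hD.time, ← hD.space]
    funext k
    simp only [changeFrame_apply, Matrix.mulVec, dotProduct, Finset.sum_smul, Finset.smul_sum,
      ← Finset.sum_add_distrib, ← Finset.sum_sub_distrib]
    refine Finset.sum_congr rfl fun l _ => ?_
    simp only [Matrix.mul_add, Matrix.add_mul, Matrix.mul_sub, Matrix.sub_mul, Matrix.mul_smul,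
      Matrix.smul_mul]
    module
  have e2 : changeFrame D (fun k => c • (N k - (2 * f k) • U - (2 * h k) • W)
        + d • (L k - (2 * f k) • W + (2 * h k) • U)) =
      fun k => c • (changeFrame D N k - (2 * (D.mulVec f) k) • timeForm
          - (2 * (D.mulVec h) k) • spaceForm)
        + d • (changeFrame D L k - (2 * (D.mulVec f) k) • spaceForm
          + (2 * (D.mulVec h) k) • timeForm) := by
    rw [← hD.time, ← hD.space]
    funext k
    simp only [changeFrame_apply, Matrix.mulVec, dotProduct, Finset.mul_sum, Finset.sum_smul,
      Finset.smul_sum, ← Finset.sum_add_distrib, ← Finset.sum_sub_distrib]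
    refine Finset.sum_congr rfl fun l _ => ?_
    simp only [Matrix.mul_add, Matrix.add_mul, Matrix.mul_sub, Matrix.sub_mul, Matrix.mul_smul,
      Matrix.smul_mul]
    module
  rw [← CKYAt_changeFrame_iff hu, ← MaxwellAt_changeFrame_iff hu,
    ← UmbilicalAt_changeFrame_iff (B := W) hu, ← UmbilicalAt_changeFrame_iff (B := U) hu, e1, e2,
    hD.metric, hD.time, hD.space]
  refine CKYAt_iff_adapted (skew N hN) (skew L hL) (fun k => ?_) (fun k => ?_) _ _ hab hcd
  · rw [← hD.time, ← hD.space, left, right, ← Finset.sum_add_distrib]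
    refine Finset.sum_eq_zero fun l _ => ?_
    rw [← smul_add, ← Matrix.add_mul, ← Matrix.mul_add, h1]
    simp
  · rw [← hD.time, ← hD.space, left, right, left, right, ← Finset.sum_add_distrib,
      ← Finset.sum_add_distrib, ← Finset.sum_sub_distrib]
    refine Finset.sum_eq_zero fun l _ => ?_
    rw [← smul_add, ← Matrix.add_mul, ← Matrix.mul_add, ← smul_add, ← Matrix.add_mul,
      ← Matrix.mul_add, ← smul_sub, ← Matrix.sub_mul, ← Matrix.mul_sub, h2]
    simp

/-! ### Matrix-valued functions and their covariant derivatives -/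

/-- A matrix-valued function with smooth entries. -/
def SmoothMatrixOn (T : E4 → Matrix (Fin 4) (Fin 4) ℝ) (s : Set E4) : Prop :=
  ∀ i j, ContDiffOn ℝ ∞ (fun y => T y i j) s

/-- A matrix-valued function with differentiable entries. -/
def DiffMatrixAt (T : E4 → Matrix (Fin 4) (Fin 4) ℝ) (x : E4) : Prop :=
  ∀ i j, DifferentiableAt ℝ (fun y => T y i j) x

theorem differentiableAt_of_contDiffOn {s : Set E4} (hs : IsOpen s) {f : E4 → ℝ}
    (hf : ContDiffOn ℝ ∞ f s) {x : E4} (hx : x ∈ s) : DifferentiableAt ℝ f x :=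
  (hf.contDiffAt (hs.mem_nhds hx)).differentiableAt (by simp)

theorem SmoothMatrixOn.diffMatrixAt {s : Set E4} (hs : IsOpen s)
    {T : E4 → Matrix (Fin 4) (Fin 4) ℝ} (hT : SmoothMatrixOn T s) {x : E4} (hx : x ∈ s) :
    DiffMatrixAt T x :=
  fun i j => differentiableAt_of_contDiffOn hs (hT i j) hx

theorem SmoothMatrixOn.mul {s : Set E4} {S T : E4 → Matrix (Fin 4) (Fin 4) ℝ}
    (hS : SmoothMatrixOn S s) (hT : SmoothMatrixOn T s) :
    SmoothMatrixOn (fun y => S y * T y) s := fun i j => by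
  simp only [Matrix.mul_apply]
  exact ContDiffOn.sum fun l _ => (hS i l).mul (hT l j)

theorem SmoothMatrixOn.neg {s : Set E4} {T : E4 → Matrix (Fin 4) (Fin 4) ℝ}
    (hT : SmoothMatrixOn T s) : SmoothMatrixOn (fun y => -T y) s := fun i j => (hT i j).neg

theorem SmoothMatrixOn.det {s : Set E4} {T : E4 → Matrix (Fin 4) (Fin 4) ℝ}
    (hT : SmoothMatrixOn T s) : ContDiffOn ℝ ∞ (fun y => (T y).det) s := by
  simp only [Matrix.det_apply']
  exact ContDiffOn.sum fun σ _ => contDiffOn_const.mul (contDiffOn_prod fun i _ => hT _ _)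

/-- By Cramer's rule each entry of the inverse is a quotient of determinants. -/
theorem SmoothMatrixOn.inv {s : Set E4} {T : E4 → Matrix (Fin 4) (Fin 4) ℝ}
    (hT : SmoothMatrixOn T s) (hu : ∀ y ∈ s, IsUnit (T y).det) :
    SmoothMatrixOn (fun y => (T y)⁻¹) s := fun i j => by
  simp only [Matrix.inv_def, Matrix.smul_apply, Ring.inverse_eq_inv', smul_eq_mul,
    Matrix.adjugate_apply]
  refine (hT.det.inv fun y hy => (hu y hy).ne_zero).mul (SmoothMatrixOn.det fun k l => ?_)
  by_cases hk : k = j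
  · subst hk
    simpa using contDiffOn_const
  · simpa [Matrix.updateRow_ne hk] using hT k l

theorem SmoothMatrixOn.mulVec {s : Set E4} {T : E4 → Matrix (Fin 4) (Fin 4) ℝ}
    (hT : SmoothMatrixOn T s) (v : Fin 4 → ℝ) : ContDiffOn ℝ ∞ (fun y => (T y).mulVec v) s := by
  rw [contDiffOn_pi]
  intro i
  simp only [Matrix.mulVec, dotProduct]
  exact ContDiffOn.sum fun l _ => (hT i l).mul contDiffOn_const

/-! ### Rules for partial derivatives. -/

theorem pd_congr {f g : E4 → ℝ} {x : E4} (h : f =ᶠ[nhds x] g) (k : Fin 4) : pd k f x = pd k g x := by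
  rw [pd, pd, h.fderiv_eq]

theorem pd_add {f g : E4 → ℝ} {x : E4} (hf : DifferentiableAt ℝ f x) (hg : DifferentiableAt ℝ g x)
    (k : Fin 4) : pd k (fun y => f y + g y) x = pd k f x + pd k g x := by
  simp only [pd]
  rw [fderiv_fun_add hf hg]; rfl

theorem pd_sub {f g : E4 → ℝ} {x : E4} (hf : DifferentiableAt ℝ f x) (hg : DifferentiableAt ℝ g x)
    (k : Fin 4) : pd k (fun y => f y - g y) x = pd k f x - pd k g x := by
  simp only [pd]
  rw [fderiv_fun_sub hf hg]; rfl

theorem pd_neg (f : E4 → ℝ) (x : E4) (k : Fin 4) : pd k (fun y => -f y) x = -pd k f x := by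
  simp only [pd]
  rw [fderiv_fun_neg]; rfl

theorem pd_mul {f g : E4 → ℝ} {x : E4} (hf : DifferentiableAt ℝ f x) (hg : DifferentiableAt ℝ g x)
    (k : Fin 4) : pd k (fun y => f y * g y) x = pd k f x * g x + f x * pd k g x := by
  simp only [pd]
  rw [fderiv_fun_mul hf hg]
  simp; ring

theorem pd_sum {f : Fin 4 → E4 → ℝ} {x : E4} (hf : ∀ i, DifferentiableAt ℝ (f i) x) (k : Fin 4) :
    pd k (fun y => ∑ i, f i y) x = ∑ i, pd k (f i) x := by
  simp only [pd]
  rw [fderiv_fun_sum fun i _ => hf i]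
  simp

theorem pd_const (c : ℝ) (x : E4) (k : Fin 4) : pd k (fun _ => c) x = 0 := by
  simp [pd]

/-- The entrywise partial derivative. -/
def matrixPd (k : Fin 4) (T : E4 → Matrix (Fin 4) (Fin 4) ℝ) (x : E4) :
    Matrix (Fin 4) (Fin 4) ℝ :=
  Matrix.of fun i j => pd k (fun y => T y i j) x

theorem matrixPd_mul {S T : E4 → Matrix (Fin 4) (Fin 4) ℝ} {x : E4} (hS : DiffMatrixAt S x)
    (hT : DiffMatrixAt T x) (k : Fin 4) :
    matrixPd k (fun y => S y * T y) x = matrixPd k S x * T x + S x * matrixPd k T x := by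
  ext i j
  simp only [matrixPd, Matrix.of_apply, Matrix.mul_apply, Matrix.add_apply]
  rw [pd_sum fun l => (hS i l).fun_mul (hT l j), ← Finset.sum_add_distrib]
  exact Finset.sum_congr rfl fun l _ => pd_mul (hS i l) (hT l j) k

theorem matrixPd_congr {S T : E4 → Matrix (Fin 4) (Fin 4) ℝ} {x : E4} (h : S =ᶠ[nhds x] T)
    (k : Fin 4) : matrixPd k S x = matrixPd k T x := by
  ext i j
  exact pd_congr (h.mono fun y hy => by rw [hy]) k

theorem matrixPd_const (C : Matrix (Fin 4) (Fin 4) ℝ) (x : E4) (k : Fin 4) :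
    matrixPd k (fun _ => C) x = 0 := by
  ext i j
  exact pd_const _ x k

theorem DiffMatrixAt.mul {S T : E4 → Matrix (Fin 4) (Fin 4) ℝ} {x : E4} (hS : DiffMatrixAt S x)
    (hT : DiffMatrixAt T x) : DiffMatrixAt (fun y => S y * T y) x := fun i j => by
  simp only [Matrix.mul_apply]
  exact DifferentiableAt.fun_sum fun l _ => (hS i l).fun_mul (hT l j)

/-! ### Covariant derivatives in matrix form. -/

/-- The Christoffel symbols `Γˡₖᵢ` as a matrix in `l`, `i`. -/
def christoffelMatrix (G : E4 → Matrix (Fin 4) (Fin 4) ℝ) (x : E4) (k : Fin 4) :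
    Matrix (Fin 4) (Fin 4) ℝ :=
  Matrix.of fun l i => christoffel G x l k i

/-- The covariant derivative of a covariant 2-tensor as a matrix. -/
def nablaMatrix (G T : E4 → Matrix (Fin 4) (Fin 4) ℝ) (x : E4) (k : Fin 4) :
    Matrix (Fin 4) (Fin 4) ℝ :=
  matrixPd k T x - (christoffelMatrix G x k).transpose * T x - T x * christoffelMatrix G x k

theorem nablaMatrix_apply (G T : E4 → Matrix (Fin 4) (Fin 4) ℝ) (x : E4) (k i j : Fin 4) :
    nablaMatrix G T x k i j = nablaForm G T x k i j := by
  simp only [nablaMatrix, nablaForm, matrixPd, christoffelMatrix, Matrix.sub_apply,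
    Matrix.mul_apply, Matrix.transpose_apply, Matrix.of_apply, mul_comm]

theorem divForm_eq_trace₃ (G T : E4 → Matrix (Fin 4) (Fin 4) ℝ) (x : E4) (j : Fin 4) :
    divForm G T x j = trace₃ (G x) (nablaMatrix G T x) j := by
  simp only [divForm, trace₃, nablaMatrix_apply]

theorem christoffel_symm {G : E4 → Matrix (Fin 4) (Fin 4) ℝ} (hG : ∀ y, (G y).transpose = G y)
    (x : E4) (l i j : Fin 4) : christoffel G x l i j = christoffel G x l j i := by
  have sy : ∀ i j, (fun y => G y i j) = fun y => G y j i := fun i j => by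
    funext y
    exact congrFun (congrFun (hG y).symm i) j
  simp only [christoffel]
  congr 1
  refine Finset.sum_congr rfl fun m _ => ?_
  rw [sy i j]
  ring

/-- Lowering the upper Christoffel index gives the matrix `C`, and the symmetric part of the Koszul
formula is `C + C.transpose = ∂ₖ G`. -/
theorem nablaMatrix_metric {G : E4 → Matrix (Fin 4) (Fin 4) ℝ} (hG : ∀ y, (G y).transpose = G y)
    {x : E4} (hu : IsUnit (G x).det) (k : Fin 4) : nablaMatrix G G x k = 0 := by
  have sy : ∀ i j, (fun y => G y i j) = fun y => G y j i := fun i j => by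
    funext y
    exact congrFun (congrFun (hG y).symm i) j
  set C : Matrix (Fin 4) (Fin 4) ℝ := Matrix.of fun l i => 1 / 2 * (pd k (fun y => G y i l) x
    + pd i (fun y => G y k l) x - pd l (fun y => G y k i) x) with hC
  have h1 : christoffelMatrix G x k = (G x)⁻¹ * C := by
    ext l i
    simp only [christoffelMatrix, christoffel, hC, Matrix.mul_apply, Matrix.of_apply,
      Finset.mul_sum]
    exact Finset.sum_congr rfl fun m _ => by ring
  have h2 : G x * christoffelMatrix G x k = C := by
    rw [h1, ← Matrix.mul_assoc, Matrix.mul_nonsing_inv _ hu, Matrix.one_mul]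
  have h3 : (christoffelMatrix G x k).transpose * G x = C.transpose := by
    rw [← h2, Matrix.transpose_mul, hG]
  rw [nablaMatrix, h2, h3]
  ext i j
  simp only [hC, matrixPd, Matrix.sub_apply, Matrix.transpose_apply, Matrix.of_apply,
    Matrix.zero_apply, sy j i]
  ring

theorem matrixPd_inv {G : E4 → Matrix (Fin 4) (Fin 4) ℝ} {s : Set E4} (hs : IsOpen s)
    (hG : SmoothMatrixOn G s) (hu : ∀ y ∈ s, IsUnit (G y).det) {x : E4} (hx : x ∈ s) (k : Fin 4) :
    matrixPd k (fun y => (G y)⁻¹) x = -((G x)⁻¹ * matrixPd k G x * (G x)⁻¹) := by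
  have e : (fun y => (G y)⁻¹ * G y) =ᶠ[nhds x] fun _ => 1 := by
    filter_upwards [hs.mem_nhds hx] with y hy
    exact Matrix.nonsing_inv_mul _ (hu y hy)
  have h := matrixPd_congr e k
  rw [matrixPd_const, matrixPd_mul ((hG.inv hu).diffMatrixAt hs hx) (hG.diffMatrixAt hs hx)] at h
  have h' := congrArg (· * (G x)⁻¹) h
  simp only [Matrix.add_mul, Matrix.zero_mul] at h'
  rw [Matrix.mul_assoc (matrixPd k _ x), Matrix.mul_nonsing_inv _ (hu x hx), Matrix.mul_one] at h'
  exact eq_neg_of_add_eq_zero_left h'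

/-- The Leibniz rule for the contraction of two tensors with the metric. -/
theorem nablaMatrix_mul_inv_mul {G S T : E4 → Matrix (Fin 4) (Fin 4) ℝ} {s : Set E4}
    (hs : IsOpen s) (hG : SmoothMatrixOn G s) (hsymm : ∀ y, (G y).transpose = G y)
    (hu : ∀ y ∈ s, IsUnit (G y).det)
    {x : E4} (hx : x ∈ s) (hS : DiffMatrixAt S x) (hT : DiffMatrixAt T x) (k : Fin 4) :
    nablaMatrix G (fun y => S y * (G y)⁻¹ * T y) x k =
      nablaMatrix G S x k * (G x)⁻¹ * T x + S x * (G x)⁻¹ * nablaMatrix G T x k := by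
  have hI := (hG.inv hu).diffMatrixAt hs hx
  have hm := nablaMatrix_metric hsymm (hu x hx) k
  have hp : matrixPd k G x =
      (christoffelMatrix G x k).transpose * G x + G x * christoffelMatrix G x k := by
    rw [nablaMatrix, sub_sub, sub_eq_zero] at hm
    exact hm
  have hi : matrixPd k (fun y => (G y)⁻¹) x =
      -((G x)⁻¹ * (christoffelMatrix G x k).transpose + christoffelMatrix G x k * (G x)⁻¹) := by
    rw [matrixPd_inv hs hG hu hx, hp, Matrix.mul_add, Matrix.add_mul, ← Matrix.mul_assoc (G x)⁻¹ (G x),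
      Matrix.nonsing_inv_mul _ (hu x hx), Matrix.one_mul, Matrix.mul_assoc, Matrix.mul_assoc,
      Matrix.mul_nonsing_inv _ (hu x hx), Matrix.mul_one]
  simp only [nablaMatrix]
  rw [matrixPd_mul (hS.mul hI) hT, matrixPd_mul hS hI, hi]
  noncomm_ring

theorem nablaMatrix_congr {G S T : E4 → Matrix (Fin 4) (Fin 4) ℝ} {x : E4} (h : S =ᶠ[nhds x] T)
    (k : Fin 4) : nablaMatrix G S x k = nablaMatrix G T x k := by
  rw [nablaMatrix, nablaMatrix, matrixPd_congr h, h.self_of_nhds]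

theorem nablaMatrix_zero (G : E4 → Matrix (Fin 4) (Fin 4) ℝ) (x : E4) (k : Fin 4) :
    nablaMatrix G (fun _ => 0) x k = 0 := by
  simp [nablaMatrix, matrixPd_const]

theorem nablaMatrix_sub {G S T : E4 → Matrix (Fin 4) (Fin 4) ℝ} {x : E4} (hS : DiffMatrixAt S x)
    (hT : DiffMatrixAt T x) (k : Fin 4) :
    nablaMatrix G (fun y => S y - T y) x k = nablaMatrix G S x k - nablaMatrix G T x k := by
  have : matrixPd k (fun y => S y - T y) x = matrixPd k S x - matrixPd k T x := by
    ext i j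
    exact pd_sub (hS i j) (hT i j) k
  rw [nablaMatrix, nablaMatrix, nablaMatrix, this]
  noncomm_ring

theorem nablaMatrix_comb {G S T : E4 → Matrix (Fin 4) (Fin 4) ℝ} {x : E4} (hS : DiffMatrixAt S x)
    (hT : DiffMatrixAt T x) {p q : E4 → ℝ} (hp : DifferentiableAt ℝ p x)
    (hq : DifferentiableAt ℝ q x) (k : Fin 4) :
    nablaMatrix G (fun y => p y • S y + q y • T y) x k =
      p x • nablaMatrix G S x k + pd k p x • S x + q x • nablaMatrix G T x k + pd k q x • T x := by
  have : matrixPd k (fun y => p y • S y + q y • T y) x = pd k p x • S x + p x • matrixPd k S x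
      + (pd k q x • T x + q x • matrixPd k T x) := by
    ext i j
    simp only [matrixPd, Matrix.of_apply, Matrix.add_apply, Matrix.smul_apply, smul_eq_mul]
    rw [pd_add (hp.fun_mul (hS i j)) (hq.fun_mul (hT i j)), pd_mul hp (hS i j), pd_mul hq (hT i j)]
  rw [nablaMatrix, nablaMatrix, nablaMatrix, this]
  simp only [Matrix.mul_add, Matrix.add_mul, Matrix.smul_mul, Matrix.mul_smul]
  module

theorem nablaMatrix_transpose {G T : E4 → Matrix (Fin 4) (Fin 4) ℝ}
    (hT : ∀ y, (T y).transpose = -T y) (x : E4) (k : Fin 4) :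
    (nablaMatrix G T x k).transpose = -nablaMatrix G T x k := by
  have : (matrixPd k T x).transpose = -matrixPd k T x := by
    ext i j
    have e : (fun y => T y j i) = fun y => -T y i j := by
      funext y
      exact congrFun (congrFun (hT y) i) j
    simp only [matrixPd, Matrix.transpose_apply, Matrix.of_apply, Matrix.neg_apply]
    rw [e, pd_neg]
  simp only [nablaMatrix, Matrix.transpose_sub, Matrix.transpose_mul, Matrix.transpose_transpose,
    this, hT]
  noncomm_ring

/-- In the cyclic sum the Christoffel terms cancel, by the symmetry of `Γ` in its lower indices and
the skewness of `T`; hence `dT` can be computed with `∇` or with partial derivatives. -/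
theorem maxwellAt_nablaMatrix_iff {G T : E4 → Matrix (Fin 4) (Fin 4) ℝ}
    (hG : ∀ y, (G y).transpose = G y) (hT : ∀ y, (T y).transpose = -T y) (x : E4) :
    MaxwellAt (G x) (nablaMatrix G T x) ↔ (∀ j, divForm G T x j = 0) ∧
      ∀ i j k, pd i (fun y => T y j k) x + pd j (fun y => T y k i) x
        + pd k (fun y => T y i j) x = 0 := by
  have sk : ∀ i j, T x j i = -T x i j := fun i j => congrFun (congrFun (hT x) i) j
  simp only [MaxwellAt, divForm_eq_trace₃]
  refine and_congr_right fun _ => forall_congr' fun i => forall_congr' fun j =>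
    forall_congr' fun k => ?_
  have : nablaMatrix G T x i j k + nablaMatrix G T x j k i + nablaMatrix G T x k i j =
      pd i (fun y => T y j k) x + pd j (fun y => T y k i) x + pd k (fun y => T y i j) x := by
    simp only [nablaMatrix_apply, nablaForm]
    have c : ∀ a b d, ∑ l, christoffel G x l a b * T x d l =
        -∑ l, christoffel G x l b a * T x l d := fun a b d => by
      rw [← Finset.sum_neg_distrib]
      refine Finset.sum_congr rfl fun l _ => ?_
      rw [sk l d, christoffel_symm hG x l a b]
      ring
    rw [c i k j, c j i k, c k j i]
    ring
  rw [this]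

/-- Covariant derivatives of the volume elements of a 2+2 structure: first constraint. -/
theorem nablaMatrix_dual_constraint {G U W : E4 → Matrix (Fin 4) (Fin 4) ℝ} {s : Set E4}
    (hs : IsOpen s) (hG : SmoothMatrixOn G s) (hsymm : ∀ y, (G y).transpose = G y)
    (hU : SmoothMatrixOn U s) (hW : SmoothMatrixOn W s)
    (hP : ∀ y ∈ s, IsDualPair (G y) (U y) (W y)) {x : E4} (hx : x ∈ s) (k : Fin 4) :
    nablaMatrix G U x k * (G x)⁻¹ * W x + U x * (G x)⁻¹ * nablaMatrix G W x k = 0 := by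
  rw [← nablaMatrix_mul_inv_mul hs hG hsymm (fun y hy => (hP y hy).unit) hx
    (hU.diffMatrixAt hs hx) (hW.diffMatrixAt hs hx), ← nablaMatrix_zero G x k]
  refine nablaMatrix_congr ?_ k
  filter_upwards [hs.mem_nhds hx] with y hy using (hP y hy).mul_dual

/-- Covariant derivatives of the volume elements of a 2+2 structure: second constraint. -/
theorem nablaMatrix_sub_constraint {G U W : E4 → Matrix (Fin 4) (Fin 4) ℝ} {s : Set E4}
    (hs : IsOpen s) (hG : SmoothMatrixOn G s) (hsymm : ∀ y, (G y).transpose = G y)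
    (hU : SmoothMatrixOn U s) (hW : SmoothMatrixOn W s)
    (hP : ∀ y ∈ s, IsDualPair (G y) (U y) (W y)) {x : E4} (hx : x ∈ s) (k : Fin 4) :
    nablaMatrix G U x k * (G x)⁻¹ * U x + U x * (G x)⁻¹ * nablaMatrix G U x k
      - (nablaMatrix G W x k * (G x)⁻¹ * W x + W x * (G x)⁻¹ * nablaMatrix G W x k) = 0 := by
  have hu := fun y hy => (hP y hy).unit
  have dI := (hG.inv hu).diffMatrixAt hs hx
  have dU := hU.diffMatrixAt hs hx
  have dW := hW.diffMatrixAt hs hx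
  rw [← nablaMatrix_mul_inv_mul hs hG hsymm hu hx dU dU,
    ← nablaMatrix_mul_inv_mul hs hG hsymm hu hx dW dW,
    ← nablaMatrix_sub ((dU.mul dI).mul dU) ((dW.mul dI).mul dW),
    ← nablaMatrix_metric hsymm (hu x hx) k]
  refine nablaMatrix_congr ?_ k
  filter_upwards [hs.mem_nhds hx] with y hy using (hP y hy).sub_eq

theorem pd_exp_mul_cos {α β : E4 → ℝ} {x : E4} (hα : DifferentiableAt ℝ α x)
    (hβ : DifferentiableAt ℝ β x) (k : Fin 4) :
    pd k (fun y => Real.exp (α y) * Real.cos (β y)) x =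
      Real.exp (α x) * Real.cos (β x) * pd k α x - Real.exp (α x) * Real.sin (β x) * pd k β x := by
  rw [pd_mul hα.exp hβ.cos]
  simp only [pd]
  rw [fderiv_exp hα, fderiv_cos hβ]
  simp
  ring

theorem pd_exp_mul_sin {α β : E4 → ℝ} {x : E4} (hα : DifferentiableAt ℝ α x)
    (hβ : DifferentiableAt ℝ β x) (k : Fin 4) :
    pd k (fun y => Real.exp (α y) * Real.sin (β y)) x =
      Real.exp (α x) * Real.sin (β x) * pd k α x + Real.exp (α x) * Real.cos (β x) * pd k β x := by
  rw [pd_mul hα.exp hβ.sin]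
  simp only [pd]
  rw [fderiv_exp hα, fderiv_sin hβ]
  simp
  ring

/-- The covariant derivative of a rescaled and duality-rotated 2-form. -/
theorem nablaMatrix_exp_rotation {G U W : E4 → Matrix (Fin 4) (Fin 4) ℝ} {x : E4}
    (hU : DiffMatrixAt U x) (hW : DiffMatrixAt W x) {α β : E4 → ℝ} (hα : DifferentiableAt ℝ α x)
    (hβ : DifferentiableAt ℝ β x) (k : Fin 4) :
    nablaMatrix G (fun y => (Real.exp (α y) * Real.cos (β y)) • U y
        + (Real.exp (α y) * Real.sin (β y)) • W y) x k =
      (Real.exp (α x) * Real.cos (β x)) •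
          (nablaMatrix G U x k + pd k α x • U x + pd k β x • W x)
        + (Real.exp (α x) * Real.sin (β x)) •
          (nablaMatrix G W x k + pd k α x • W x - pd k β x • U x) := by
  rw [nablaMatrix_comb hU hW (hα.exp.fun_mul hβ.cos) (hα.exp.fun_mul hβ.sin), pd_exp_mul_cos hα hβ,
    pd_exp_mul_sin hα hβ]
  module

/-! ### Umbilical kernels -/

/-- Differentiate `B Y = 0` along `X`. The derivative of `Y` modulo the kernel of `B` thus depends
only on the value of `Y` at the point, which is what makes the second fundamental form a tensor. -/
theorem mulVec_nablaVec {G B : E4 → Matrix (Fin 4) (Fin 4) ℝ} {s : Set E4} (hs : IsOpen s)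
    (hB : SmoothMatrixOn B s) {X Y : E4 → Fin 4 → ℝ} (hY : ContDiffOn ℝ ∞ Y s)
    (hYk : ∀ y ∈ s, (B y).mulVec (Y y) = 0) {x : E4} (hx : x ∈ s) :
    (B x).mulVec (nablaVec G X Y x) =
      -∑ k, X x k • (nablaMatrix G B x k).mulVec (Y x) := by
  have hd : ∀ j, DifferentiableAt ℝ (fun y => Y y j) x := fun j =>
    differentiableAt_of_contDiffOn hs (contDiffOn_pi.1 hY j) hx
  have hBd := hB.diffMatrixAt hs hx
  have e : nablaVec G X Y x = ∑ k, X x k • ((fun i => pd k (fun y => Y y i) x)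
      + (christoffelMatrix G x k).mulVec (Y x)) := by
    funext i
    simp [nablaVec, christoffelMatrix, Matrix.mulVec, dotProduct, Finset.sum_apply, mul_add]
  have leib : ∀ k, (B x).mulVec (fun i => pd k (fun y => Y y i) x) =
      -(matrixPd k B x).mulVec (Y x) := fun k => by
    funext i
    have h0 : (fun y => ∑ j, B y i j * Y y j) =ᶠ[nhds x] fun _ => 0 := by
      filter_upwards [hs.mem_nhds hx] with y hy
      exact congrFun (hYk y hy) i
    have h1 := pd_congr h0 k
    rw [pd_const, pd_sum fun j => (hBd i j).fun_mul (hd j)] at h1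
    simp_rw [fun j => pd_mul (hBd i j) (hd j) k] at h1
    rw [Finset.sum_add_distrib] at h1
    simp only [Matrix.mulVec, dotProduct, Pi.neg_apply, matrixPd, Matrix.of_apply]
    linarith
  rw [e, Matrix.mulVec_sum, ← Finset.sum_neg_distrib]
  refine Finset.sum_congr rfl fun k _ => ?_
  rw [Matrix.mulVec_smul, Matrix.mulVec_add, leib, nablaMatrix, Matrix.sub_mulVec,
    Matrix.sub_mulVec, ← Matrix.mulVec_mulVec, hYk x hx, Matrix.mulVec_zero, ← smul_neg,
    ← Matrix.mulVec_mulVec]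
  congr 1
  abel

/-- The field `P` serves to extend vectors: each `v` in the kernel of `B x` is the value at `x` of
the smooth field `y ↦ P y v`, which takes values in the kernel of `B`. Testing on such fields
recovers the pointwise condition. -/
theorem umbilicalAt_iff_fields {G B P : E4 → Matrix (Fin 4) (Fin 4) ℝ} {s : Set E4}
    (hs : IsOpen s) (hB : SmoothMatrixOn B s) (hP : SmoothMatrixOn P s)
    (hBP : ∀ y ∈ s, B y * P y = 0) {x : E4} (hx : x ∈ s)
    (hPk : ∀ v, (B x).mulVec v = 0 → (P x).mulVec v = v) :
    UmbilicalAt (G x) (B x) (nablaMatrix G B x) ↔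
      ∃ Z : Fin 4 → ℝ, ∀ X Y : E4 → Fin 4 → ℝ,
        ContDiffOn ℝ ∞ X s → ContDiffOn ℝ ∞ Y s →
        (∀ y ∈ s, (B y).mulVec (X y) = 0) → (∀ y ∈ s, (B y).mulVec (Y y) = 0) →
        (B x).mulVec (fun k => nablaVec G X Y x k + nablaVec G Y X x k
          - 2 * (∑ k, ∑ j, X x k * Y x j * G x k j) * Z k) = 0 := by
  have key : ∀ (Z : Fin 4 → ℝ) (X Y : E4 → Fin 4 → ℝ),
        ContDiffOn ℝ ∞ X s → ContDiffOn ℝ ∞ Y s →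
        (∀ y ∈ s, (B y).mulVec (X y) = 0) → (∀ y ∈ s, (B y).mulVec (Y y) = 0) → ∀ i,
        (B x).mulVec (fun k => nablaVec G X Y x k + nablaVec G Y X x k
          - 2 * (∑ k, ∑ j, X x k * Y x j * G x k j) * Z k) i =
        -((∑ k, ∑ j, (X x k * Y x j + Y x k * X x j) * nablaMatrix G B x k i j)
          + 2 * (∑ k, ∑ j, X x k * Y x j * G x k j) * (B x).mulVec Z i) := by
    intro Z X Y hX hY hXk hYk i
    have e : (fun k => nablaVec G X Y x k + nablaVec G Y X x k
          - 2 * (∑ k, ∑ j, X x k * Y x j * G x k j) * Z k) =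
        nablaVec G X Y x + nablaVec G Y X x - (2 * (∑ k, ∑ j, X x k * Y x j * G x k j)) • Z := rfl
    rw [e, Matrix.mulVec_sub, Matrix.mulVec_add, mulVec_nablaVec hs hB hY hYk hx,
      mulVec_nablaVec hs hB hX hXk hx, Matrix.mulVec_smul]
    have c : ∀ X Y : Fin 4 → ℝ, (∑ k, X k • (nablaMatrix G B x k).mulVec Y) i =
        ∑ k, ∑ j, X k * Y j * nablaMatrix G B x k i j := fun X Y => by
      simp only [Finset.sum_apply, Pi.smul_apply, smul_eq_mul, Matrix.mulVec, dotProduct,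
        Finset.mul_sum]
      exact Finset.sum_congr rfl fun k _ => Finset.sum_congr rfl fun j _ => by ring
    simp only [Pi.sub_apply, Pi.add_apply, Pi.neg_apply, c, add_mul, Finset.sum_add_distrib,
      Pi.smul_apply, smul_eq_mul]
    ring
  refine exists_congr fun Z => ⟨fun h X Y hX hY hXk hYk => ?_, fun h X Y hX hY i => ?_⟩
  · funext i
    rw [key Z X Y hX hY hXk hYk i, h _ _ (hXk x hx) (hYk x hx) i, neg_zero, Pi.zero_apply]
  · have tang : ∀ v, ∀ y ∈ s, (B y).mulVec ((P y).mulVec v) = 0 := fun v y hy => by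
      rw [Matrix.mulVec_mulVec, hBP y hy, Matrix.zero_mulVec]
    have h1 := key Z (fun y => (P y).mulVec X) (fun y => (P y).mulVec Y) (hP.mulVec X)
      (hP.mulVec Y) (tang X) (tang Y) i
    rw [h _ _ (hP.mulVec X) (hP.mulVec Y) (tang X) (tang Y)] at h1
    simp only [hPk X hX, hPk Y hY, Pi.zero_apply] at h1
    linarith

/-! ### Linear algebra of a Lorentzian vector space -/

section LinearAlgebra

variable {E : Type*} [AddCommGroup E] [Module ℝ E]

/-- The matrix of a bilinear form in a basis. -/
def gram (β : E →ₗ[ℝ] E →ₗ[ℝ] ℝ) (c : Module.Basis (Fin 4) ℝ E) : Matrix (Fin 4) (Fin 4) ℝ :=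
  Matrix.of fun i j => β (c i) (c j)

/-- The bilinear form obtained by fixing all but the first two arguments of an alternating map. -/
def pairForm {n : ℕ} (A : E [⋀^Fin (n + 2)]→ₗ[ℝ] ℝ) (v : Fin n → E) : E →ₗ[ℝ] E →ₗ[ℝ] ℝ :=
  LinearMap.mk₂ ℝ (fun x y => ((A.curryLeft x).curryLeft y) v) (by simp) (by simp) (by simp)
    (by simp)

theorem pairForm_apply {n : ℕ} (A : E [⋀^Fin (n + 2)]→ₗ[ℝ] ℝ) (v : Fin n → E) (x y : E) :
    pairForm A v x y = A (Matrix.vecCons x (Matrix.vecCons y v)) := rfl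

theorem apply_eq_gram (β : E →ₗ[ℝ] E →ₗ[ℝ] ℝ) (c : Module.Basis (Fin 4) ℝ E) (x y : E) :
    β x y = c.repr x ⬝ᵥ (gram β c).mulVec (c.repr y) := by
  conv_lhs => rw [← c.sum_repr x, ← c.sum_repr y]
  simp only [map_sum, map_smul, LinearMap.sum_apply, LinearMap.smul_apply, smul_eq_mul, dotProduct,
    Matrix.mulVec, gram, Matrix.of_apply, Finset.mul_sum]
  rw [Finset.sum_comm]
  exact Finset.sum_congr rfl fun i _ => Finset.sum_congr rfl fun j _ => by ring

theorem apply_basis_eq_gram (β : E →ₗ[ℝ] E →ₗ[ℝ] ℝ) (c : Module.Basis (Fin 4) ℝ E) (y : E)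
    (i : Fin 4) : β (c i) y = (gram β c).mulVec (c.repr y) i := by
  rw [apply_eq_gram β c, Module.Basis.repr_self, Finsupp.single_eq_pi_single]
  simp

/-- The coefficients of the basis `b` in the basis `c`. -/
def frameMatrix (b c : Module.Basis (Fin 4) ℝ E) : Matrix (Fin 4) (Fin 4) ℝ :=
  Matrix.of fun a i => c.repr (b a) i

theorem gram_change (β : E →ₗ[ℝ] E →ₗ[ℝ] ℝ) (b c : Module.Basis (Fin 4) ℝ E) :
    gram β b = frameMatrix b c * gram β c * (frameMatrix b c).transpose := by
  ext i j
  rw [mul_mul_transpose_apply, gram, Matrix.of_apply, apply_eq_gram β c]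
  rfl

theorem alternating_two_swap (A : E [⋀^Fin 2]→ₗ[ℝ] ℝ) (x y : E) : A ![y, x] = -A ![x, y] := by
  rw [← A.map_swap ![x, y] (show (0 : Fin 2) ≠ 1 by decide)]
  congr 1
  ext i
  fin_cases i <;> simp

theorem gram_transpose_of_alternating (A : E [⋀^Fin 2]→ₗ[ℝ] ℝ) (c : Module.Basis (Fin 4) ℝ E) :
    (gram (pairForm A ![]) c).transpose = -gram (pairForm A ![]) c := by
  ext i j
  exact alternating_two_swap A (c i) (c j)

/-- The Levi-Civita symbol. -/
def leviCivita (v : Fin 4 → Fin 4) : ℝ :=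
  (((v 1 : ℕ) - (v 0 : ℕ)) * ((v 2 : ℕ) - (v 0 : ℕ)) * ((v 3 : ℕ) - (v 0 : ℕ)) *
    ((v 2 : ℕ) - (v 1 : ℕ)) * ((v 3 : ℕ) - (v 1 : ℕ)) * ((v 3 : ℕ) - (v 2 : ℕ))) / 12

/-- `leviCivita` is a Vandermonde product divided by `12`, its value on the identity. It vanishes on
repeated indices, and on permutations it is the sign, an integer identity checked on all of them. -/
theorem alternating_four_apply (η : E [⋀^Fin 4]→ₗ[ℝ] ℝ) (c : Fin 4 → E) (v : Fin 4 → Fin 4) :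
    η (fun i => c (v i)) = leviCivita v * η c := by
  by_cases hv : Function.Injective v
  · set σ : Equiv.Perm (Fin 4) := Equiv.ofBijective v (Finite.injective_iff_bijective.1 hv)
    have hs : ∀ σ : Equiv.Perm (Fin 4), (((σ 1 : ℕ) : ℤ) - (σ 0 : ℕ)) * ((σ 2 : ℕ) - (σ 0 : ℕ)) *
        ((σ 3 : ℕ) - (σ 0 : ℕ)) * ((σ 2 : ℕ) - (σ 1 : ℕ)) * ((σ 3 : ℕ) - (σ 1 : ℕ)) *
        ((σ 3 : ℕ) - (σ 2 : ℕ)) = 12 * (Equiv.Perm.sign σ : ℤ) := by decide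
    have h1 : η (fun i => c (v i)) = ((Equiv.Perm.sign σ : ℤ) : ℝ) * η c := by
      have := η.map_perm c σ
      rw [Units.smul_def, zsmul_eq_mul] at this
      exact this
    have h2 := congrArg (Int.cast : ℤ → ℝ) (hs σ)
    push_cast at h2
    have h3 : leviCivita v = ((Equiv.Perm.sign σ : ℤ) : ℝ) := by
      have : ∀ i, v i = σ i := fun i => rfl
      simp only [leviCivita, this]
      linarith
    rw [h1, h3]
  · rw [η.map_eq_zero_of_not_injective (fun i => c (v i))
      fun h => hv (Function.Injective.of_comp (f := c) h)]
    simp only [Function.Injective, not_forall] at hv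
    obtain ⟨i, j, hij, hne⟩ := hv
    have : leviCivita v = 0 := by
      fin_cases i <;> fin_cases j <;> simp at hne hij <;> simp [leviCivita, hij]
    rw [this, zero_mul]

/-- The components of the Hodge dual in an orthonormal frame. -/
theorem sum_mink_leviCivita {A : Matrix (Fin 4) (Fin 4) ℝ} (hA : A.transpose = -A) :
    (Matrix.of fun c d => 1 / 2 * ∑ a, ∑ b, mink a * mink b * A a b * leviCivita ![a, b, c, d]) =
      -starMatrix A := by
  have sk : ∀ i j, A j i = -A i j := fun i j => congrFun (congrFun hA i) j
  ext c d
  fin_cases c <;> fin_cases d <;>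
    simp [Fin.sum_univ_four, mink, leviCivita, starMatrix, sk 0 1, sk 0 2, sk 0 3, sk 1 2, sk 1 3,
      sk 2 3] <;> ring

/-- Both are polynomial identities for a simple 2-form: its product with its dual vanishes, and the
difference of squares is the metric times `g(u,w)² - g(u,u) g(w,w)`, which is `1` here. -/
theorem unitary_relations {u w : Fin 4 → ℝ} (huu : u ⬝ᵥ minkMatrix.mulVec u = -1)
    (hww : w ⬝ᵥ minkMatrix.mulVec w = 1) (huw : u ⬝ᵥ minkMatrix.mulVec w = 0)
    {A : Matrix (Fin 4) (Fin 4) ℝ}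
    (hA : A = Matrix.vecMulVec (minkMatrix.mulVec u) (minkMatrix.mulVec w)
      - Matrix.vecMulVec (minkMatrix.mulVec w) (minkMatrix.mulVec u)) :
    A * minkMatrix * starMatrix A = 0 ∧
      A * minkMatrix * A - starMatrix A * minkMatrix * starMatrix A = minkMatrix := by
  have e : ∀ i j, A i j = mink i * u i * (mink j * w j) - mink i * w i * (mink j * u j) :=
    fun i j => by
      rw [hA]
      simp [minkMatrix, Matrix.mulVec_diagonal, Matrix.vecMulVec_apply]
  have K : (u ⬝ᵥ minkMatrix.mulVec w) ^ 2 - (u ⬝ᵥ minkMatrix.mulVec u) *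
      (w ⬝ᵥ minkMatrix.mulVec w) = 1 := by
    rw [huu, hww, huw]; norm_num
  simp [minkMatrix, Matrix.mulVec_diagonal, dotProduct, Fin.sum_univ_four, mink] at K
  constructor
  · ext i j
    simp only [Matrix.mul_apply, Fin.sum_univ_four, minkMatrix, Matrix.diagonal_apply]
    fin_cases i <;> fin_cases j <;> simp [starMatrix, e, mink] <;> ring
  · have : A * minkMatrix * A - starMatrix A * minkMatrix * starMatrix A =
        ((-(u 0 * w 0) + u 1 * w 1 + u 2 * w 2 + u 3 * w 3) ^ 2
          - (-(u 0 * u 0) + u 1 * u 1 + u 2 * u 2 + u 3 * u 3) *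
            (-(w 0 * w 0) + w 1 * w 1 + w 2 * w 2 + w 3 * w 3)) • minkMatrix := by
      ext i j
      simp only [Matrix.sub_apply, Matrix.mul_apply, Fin.sum_univ_four, minkMatrix,
        Matrix.diagonal_apply, Matrix.smul_apply, smul_eq_mul]
      fin_cases i <;> fin_cases j <;> simp [starMatrix, e, mink] <;> ring
    rw [this, K, one_smul]

/-- The Cauchy-Schwarz inequality on the spatial parts gives `(u 0 * h 0)² ≤ (u 0 ² - 1) |h|²`, with
`|h|` the spatial norm of `h`. Hence `h 0 ² < |h|²`, unless the spatial part of `h` vanishes, and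
then `h = 0`. -/
theorem mink_pos_of_orthogonal {u h : Fin 4 → ℝ} (huu : u ⬝ᵥ minkMatrix.mulVec u = -1)
    (huh : u ⬝ᵥ minkMatrix.mulVec h = 0) (h0 : h ≠ 0) : 0 < h ⬝ᵥ minkMatrix.mulVec h := by
  simp [minkMatrix, Matrix.mulVec_diagonal, dotProduct, Fin.sum_univ_four, mink] at huu huh ⊢
  have cs : (u 1 * h 1 + u 2 * h 2 + u 3 * h 3) ^ 2 ≤
      (u 1 ^ 2 + u 2 ^ 2 + u 3 ^ 2) * (h 1 ^ 2 + h 2 ^ 2 + h 3 ^ 2) := by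
    linarith [sq_nonneg (u 1 * h 2 - u 2 * h 1), sq_nonneg (u 1 * h 3 - u 3 * h 1),
      sq_nonneg (u 2 * h 3 - u 3 * h 2)]
  have e1 : u 1 * h 1 + u 2 * h 2 + u 3 * h 3 = u 0 * h 0 := by linarith
  have e2 : u 1 ^ 2 + u 2 ^ 2 + u 3 ^ 2 = u 0 ^ 2 - 1 := by linarith
  rw [e1, e2] at cs
  have hu0 : 1 ≤ u 0 ^ 2 := by nlinarith [sq_nonneg (u 1), sq_nonneg (u 2), sq_nonneg (u 3)]
  rcases (by positivity : 0 ≤ h 1 ^ 2 + h 2 ^ 2 + h 3 ^ 2).eq_or_lt with hS | hS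
  · exfalso
    have h1 : h 1 = 0 := by nlinarith [sq_nonneg (h 1), sq_nonneg (h 2), sq_nonneg (h 3)]
    have h2 : h 2 = 0 := by nlinarith [sq_nonneg (h 1), sq_nonneg (h 2), sq_nonneg (h 3)]
    have h3 : h 3 = 0 := by nlinarith [sq_nonneg (h 1), sq_nonneg (h 2), sq_nonneg (h 3)]
    rw [h1, h2, h3] at e1
    have h00 : h 0 = 0 := by
      rcases mul_eq_zero.1 (show u 0 * h 0 = 0 by linarith) with h | h
      · rw [h] at hu0; norm_num at hu0
      · exact h
    exact h0 (by ext i; fin_cases i <;> simp [h00, h1, h2, h3])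
  · have : u 0 ^ 2 * h 0 ^ 2 < u 0 ^ 2 * (h 1 ^ 2 + h 2 ^ 2 + h 3 ^ 2) := by nlinarith
    have := lt_of_mul_lt_mul_left this (sq_nonneg _)
    linarith

theorem sum_mul_eq_trace (X Y : Matrix (Fin 4) (Fin 4) ℝ) :
    ∑ a, ∑ b, X a b * Y a b = (X * Y.transpose).trace := by
  simp [Matrix.trace, Matrix.mul_apply]

/-- Raising both indices commutes with a change of frame. -/
theorem sum_mink_mul_eq {G D : Matrix (Fin 4) (Fin 4) ℝ} (h : D * G * D.transpose = minkMatrix)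
    (A B : Matrix (Fin 4) (Fin 4) ℝ) :
    ∑ a, ∑ b, mink a * mink b * (D * A * D.transpose) a b * (D * B * D.transpose) a b =
      ∑ k, ∑ l, (G⁻¹ * A * G⁻¹) k l * B k l := by
  have hu := (isUnit_det_of_mul_mul_transpose h).1
  have huT : IsUnit D.transpose.det := by rwa [Matrix.det_transpose]
  have e : ∀ a b, mink a * mink b * (D * A * D.transpose) a b =
      (minkMatrix * (D * A * D.transpose) * minkMatrix) a b := fun a b => by
    rw [minkMatrix, Matrix.mul_diagonal, Matrix.diagonal_mul]; ring
  simp_rw [e]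
  rw [sum_mul_eq_trace, sum_mul_eq_trace, minkMatrix_eq h, Matrix.transpose_mul,
    Matrix.transpose_mul, Matrix.transpose_transpose]
  calc _ = (D.transpose⁻¹ * (G⁻¹ * (D⁻¹ * D) * A * (D.transpose * D.transpose⁻¹) * G⁻¹ *
        (D⁻¹ * D) * B.transpose * D.transpose)).trace := by simp only [Matrix.mul_assoc]
    _ = _ := by
      rw [Matrix.trace_mul_comm, Matrix.nonsing_inv_mul _ hu, Matrix.mul_nonsing_inv _ huT,
        Matrix.mul_one, Matrix.mul_one, Matrix.mul_one, Matrix.mul_assoc _ D.transpose,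
        Matrix.mul_nonsing_inv _ huT, Matrix.mul_one]

theorem gram_unitary {g : E →ₗ[ℝ] E →ₗ[ℝ] ℝ} (hg : ∀ x y, g x y = g y x)
    {A : E [⋀^Fin 2]→ₗ[ℝ] ℝ} {u w : E}
    (hA : ∀ x y, A ![x, y] = g u x * g w y - g w x * g u y) (c : Module.Basis (Fin 4) ℝ E) :
    gram (pairForm A ![]) c =
      Matrix.vecMulVec ((gram g c).mulVec (c.repr u)) ((gram g c).mulVec (c.repr w))
        - Matrix.vecMulVec ((gram g c).mulVec (c.repr w)) ((gram g c).mulVec (c.repr u)) := by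
  ext i j
  simp only [Matrix.sub_apply, Matrix.vecMulVec_apply, ← apply_basis_eq_gram]
  exact (hA _ _).trans (by rw [hg u, hg w, hg w, hg u])

end LinearAlgebra

section Manifold

variable {M : Type*} [TopologicalSpace M] [ChartedSpace E4 M]

/-! ### Chart frames -/

section Chart

variable [IsManifold (𝓡 4) ∞ M]

/-- The coordinate frame of a chart as a basis of the tangent space. -/
def chartBasis {e : OpenPartialHomeomorph M E4} (he : e ∈ atlas E4 M) {x : E4}
    (hx : x ∈ e.target) : Module.Basis (Fin 4) ℝ (TangentSpace (𝓡 4) (e.symm x)) :=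
  haveI : IsManifold (𝓡 4) 1 M := IsManifold.of_le (n := ∞) (by simp)
  Module.Basis.map (M' := TangentSpace (𝓡 4) (e.symm x))
    ((EuclideanSpace.basisFun (Fin 4) ℝ).toBasis : Module.Basis (Fin 4) ℝ E4)
    (LinearEquiv.ofBijective (M := E4) (mfderiv (𝓡 4) (𝓡 4) e.symm x).toLinearMap
      ((mdifferentiable_of_mem_atlas (I := 𝓡 4) he).symm.mfderiv_bijective hx))

theorem chartBasis_apply {e : OpenPartialHomeomorph M E4} (he : e ∈ atlas E4 M) {x : E4}
    (hx : x ∈ e.target) (i : Fin 4) : chartBasis he hx i = frame e x i := by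
  have h : (EuclideanSpace.basisFun (Fin 4) ℝ).toBasis i = EuclideanSpace.single i (1 : ℝ) := by
    simp
  exact (Module.Basis.map_apply (M' := TangentSpace (𝓡 4) (e.symm x)) _ _ i).trans
    (congrArg (fun v : E4 => mfderiv (𝓡 4) (𝓡 4) e.symm x v) h)

theorem bilinComp_eq_gram (T : BilinField M) {e : OpenPartialHomeomorph M E4}
    (he : e ∈ atlas E4 M) {x : E4} (hx : x ∈ e.target) :
    bilinComp T e x = gram (T (e.symm x)) (chartBasis he hx) := by
  ext i j
  simp only [bilinComp, gram, Matrix.of_apply, chartBasis_apply]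

theorem formComp_eq_gram (A : TwoForm M) {e : OpenPartialHomeomorph M E4}
    (he : e ∈ atlas E4 M) {x : E4} (hx : x ∈ e.target) :
    formComp A e x = gram (pairForm (A (e.symm x)) ![]) (chartBasis he hx) := by
  ext i j
  simp only [formComp, gram, Matrix.of_apply, chartBasis_apply]
  rfl

theorem vec_eq_sum {e : OpenPartialHomeomorph M E4} (he : e ∈ atlas E4 M) {x : E4}
    (hx : x ∈ e.target) (c : Fin 4 → ℝ) : vec e x c = ∑ i, c i • chartBasis he hx i := by
  simp only [vec, chartBasis_apply]

theorem repr_vec {e : OpenPartialHomeomorph M E4} (he : e ∈ atlas E4 M) {x : E4}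
    (hx : x ∈ e.target) (c : Fin 4 → ℝ) :
    ((chartBasis he hx).repr (vec e x c) : Fin 4 → ℝ) = c := by
  rw [vec_eq_sum he hx, Module.Basis.repr_sum_self]

theorem contDiffOn_comp_chart {f : M → ℝ} (hf : ContMDiff (𝓡 4) 𝓘(ℝ, ℝ) ∞ f)
    {e : OpenPartialHomeomorph M E4} (he : e ∈ atlas E4 M) :
    ContDiffOn ℝ ∞ (fun y => f (e.symm y)) e.target := by
  rw [← contMDiffOn_iff_contDiffOn]
  exact hf.comp_contMDiffOn
    (contMDiffOn_symm_of_mem_maximalAtlas (IsManifold.subset_maximalAtlas he))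

end Chart

/-! ### The metric and the Hodge dual in orthonormal and coordinate frames. -/

theorem formComp_transpose (A : TwoForm M) (e : OpenPartialHomeomorph M E4) (y : E4) :
    (formComp A e y).transpose = -formComp A e y := by
  ext i j
  exact alternating_two_swap (A (e.symm y)) (frame e y i) (frame e y j)

variable (S : Spacetime M)

theorem gram_orthoFrame (p : M) : gram (S.g p) (S.orthoFrame p) = minkMatrix := by
  ext i j
  rw [minkMatrix, Matrix.diagonal_apply]
  exact (S.exists_frame p).choose_spec.1 i j

theorem η_orthoFrame (p : M) : S.η p (S.orthoFrame p) = 1 := (S.exists_frame p).choose_spec.2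

theorem g_symm (p : M) (x y : TangentSpace (𝓡 4) p) : S.g p x y = S.g p y x := by
  rw [apply_eq_gram (S.g p) (S.orthoFrame p), apply_eq_gram (S.g p) (S.orthoFrame p) y,
    gram_orthoFrame, Matrix.dotProduct_mulVec, ← Matrix.mulVec_transpose, minkMatrix,
    Matrix.diagonal_transpose, dotProduct_comm]

theorem bilinComp_transpose (e : OpenPartialHomeomorph M E4) (y : E4) :
    (bilinComp S.g e y).transpose = bilinComp S.g e y := by
  ext i j
  exact S.g_symm (e.symm y) (frame e y j) (frame e y i)

theorem hodge_apply (A : TwoForm M) (p : M) (x y : TangentSpace (𝓡 4) p) :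
    S.hodge A p ![x, y] = 1 / 2 * ∑ a, ∑ b,
      mink a * mink b * A p ![S.orthoFrame p a, S.orthoFrame p b] *
        S.η p ![S.orthoFrame p a, S.orthoFrame p b, x, y] := by
  have sum : ∀ f : Fin 4 → (TangentSpace (𝓡 4) p) [⋀^Fin 2]→ₗ[ℝ] ℝ,
      (∑ a, f a) ![x, y] = ∑ a, f a ![x, y] := fun f => by
    simp [Fin.sum_univ_four]
  simp only [hodge, AlternatingMap.smul_apply, sum, smul_eq_mul]
  rfl

/-- The minus sign reflects that `starMatrix` is the dual for the opposite orientation, chosen so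
that it maps `timeForm` to `spaceForm`. It is harmless because the relations of a dual pair are even
in the dual form. -/
theorem gram_hodge_orthoFrame (A : TwoForm M) (p : M) :
    gram (pairForm (S.hodge A p) ![]) (S.orthoFrame p) =
      -starMatrix (gram (pairForm (A p) ![]) (S.orthoFrame p)) := by
  rw [← sum_mink_leviCivita (gram_transpose_of_alternating (A p) (S.orthoFrame p))]
  ext c d
  have h : ∀ a b, S.η p ![S.orthoFrame p a, S.orthoFrame p b, S.orthoFrame p c,
      S.orthoFrame p d] = leviCivita ![a, b, c, d] := fun a b => by
    rw [← mul_one (leviCivita _), ← S.η_orthoFrame p, ← alternating_four_apply]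
    congr 1
    funext i
    fin_cases i <;> rfl
  refine (S.hodge_apply A p _ _).trans ?_
  simp only [h]
  rfl

/-- The contraction of a 2-form with the volume element is independent of the frame. -/
theorem hodge_apply_basis (A : TwoForm M) (p : M)
    (c : Module.Basis (Fin 4) ℝ (TangentSpace (𝓡 4) p)) (i j : Fin 4) :
    S.hodge A p ![c i, c j] = 1 / 2 * ∑ k, ∑ l,
      ((gram (S.g p) c)⁻¹ * gram (pairForm (A p) ![]) c * (gram (S.g p) c)⁻¹) k l *
        (leviCivita ![k, l, i, j] * S.η p c) := by
  have h := gram_change (S.g p) (S.orthoFrame p) c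
  rw [gram_orthoFrame] at h
  have e := sum_mink_mul_eq h.symm (gram (pairForm (A p) ![]) c)
    (gram (pairForm (S.η p) ![c i, c j]) c)
  rw [← gram_change, ← gram_change] at e
  rw [hodge_apply]
  congr 1
  refine Eq.trans ?_ (e.trans ?_)
  · rfl
  · refine Finset.sum_congr rfl fun k _ => Finset.sum_congr rfl fun l _ => ?_
    congr 1
    rw [← alternating_four_apply, gram, Matrix.of_apply, pairForm_apply]
    congr 1
    funext m
    fin_cases m <;> rfl

variable [IsManifold (𝓡 4) ∞ M]

theorem isUnit_det_bilinComp {e : OpenPartialHomeomorph M E4} (he : e ∈ atlas E4 M) {x : E4}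
    (hx : x ∈ e.target) : IsUnit (bilinComp S.g e x).det := by
  have h := gram_change (S.g (e.symm x)) (S.orthoFrame (e.symm x)) (chartBasis he hx)
  rw [gram_orthoFrame, ← bilinComp_eq_gram] at h
  exact (isUnit_det_of_mul_mul_transpose h.symm).2

/-- The orthonormal frames are chosen independently at each point, so smoothness is invisible in the
definition. In the coordinate frame the dual is expressed through the inverse metric, the form and
`η`, all of which are smooth. -/
theorem smooth_hodge {A : TwoForm M} (hA : A.IsSmooth) : (S.hodge A).IsSmooth := by
  intro e he i j
  have hI := SmoothMatrixOn.inv (T := bilinComp S.g e) (S.g_smooth e he)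
    fun y hy => S.isUnit_det_bilinComp he hy
  have hK := (hI.mul (T := formComp A e) (hA e he)).mul hI
  have hs : ContDiffOn ℝ ∞ (fun y => 1 / 2 * ∑ k, ∑ l,
      ((bilinComp S.g e y)⁻¹ * formComp A e y * (bilinComp S.g e y)⁻¹) k l *
        (leviCivita ![k, l, i, j] * S.η (e.symm y) (frame e y))) e.target :=
    contDiffOn_const.mul (ContDiffOn.sum fun k _ => ContDiffOn.sum fun l _ =>
      (hK k l).mul (contDiffOn_const.mul (S.η_smooth e he)))
  refine hs.congr fun y hy => ?_
  have hc : (chartBasis he hy : Fin 4 → _) = frame e y := funext fun i => chartBasis_apply he hy i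
  have := S.hodge_apply_basis A (e.symm y) (chartBasis he hy) i j
  rw [← bilinComp_eq_gram, ← formComp_eq_gram, hc] at this
  exact this

/-- The relations are checked in an orthonormal frame, where they are `unitary_relations`, and
carried to the coordinate frame by congruence. -/
theorem IsUnitary.isDualPair {S : Spacetime M} {U : TwoForm M} (hU : S.IsUnitary U)
    {e : OpenPartialHomeomorph M E4} (he : e ∈ atlas E4 M) {x : E4} (hx : x ∈ e.target) :
    IsDualPair (bilinComp S.g e x) (formComp U e x) (formComp (S.hodge U) e x) := by
  obtain ⟨u, w, huu, hww, huw, hUx⟩ := hU.unitary (e.symm x)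
  have h := gram_change (S.g (e.symm x)) (S.orthoFrame (e.symm x)) (chartBasis he hx)
  rw [gram_orthoFrame, ← bilinComp_eq_gram] at h
  have hD := (isUnit_det_of_mul_mul_transpose h.symm).1
  have hb := gram_unitary (S.g_symm _) hUx (S.orthoFrame (e.symm x))
  rw [apply_eq_gram _ (S.orthoFrame (e.symm x)), gram_orthoFrame] at huu hww huw
  rw [gram_orthoFrame] at hb
  obtain ⟨r1, r2⟩ := unitary_relations huu hww huw hb
  have hU' := gram_change (pairForm (U (e.symm x)) ![]) (S.orthoFrame (e.symm x)) (chartBasis he hx)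
  have hW' := gram_change (pairForm (S.hodge U (e.symm x)) ![]) (S.orthoFrame (e.symm x))
    (chartBasis he hx)
  rw [← formComp_eq_gram] at hU' hW'
  have hs : starMatrix (gram (pairForm (U (e.symm x)) ![]) (S.orthoFrame (e.symm x))) =
      -gram (pairForm (S.hodge U (e.symm x)) ![]) (S.orthoFrame (e.symm x)) := by
    rw [gram_hodge_orthoFrame, neg_neg]
  rw [hs, hW', hU', Matrix.mul_neg, neg_eq_zero, mul_minkMatrix_mul h.symm] at r1
  rw [hs, hW', hU', Matrix.neg_mul, Matrix.neg_mul, Matrix.mul_neg, neg_neg,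
    mul_minkMatrix_mul h.symm, mul_minkMatrix_mul h.symm, ← Matrix.sub_mul, ← Matrix.mul_sub] at r2
  refine ⟨S.bilinComp_transpose e x, S.isUnit_det_bilinComp he hx, formComp_transpose _ _ _,
    formComp_transpose _ _ _, ?_, ?_⟩
  · rw [← inv_mul_mul_transpose (G := formComp U e x * _ * _) hD, r1]
    simp
  · rw [← inv_mul_mul_transpose (G := formComp U e x * _ * _ - _) hD, r2, h,
      inv_mul_mul_transpose hD]

theorem IsUnitary.exists_isAdaptedFrame {S : Spacetime M} {U : TwoForm M} (hU : S.IsUnitary U)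
    {e : OpenPartialHomeomorph M E4} (he : e ∈ atlas E4 M) {x : E4} (hx : x ∈ e.target) :
    ∃ D, IsAdaptedFrame (bilinComp S.g e x) (formComp U e x) (formComp (S.hodge U) e x) D := by
  obtain ⟨u, w, huu, hww, huw, hUx⟩ := hU.unitary (e.symm x)
  have hc := gram_unitary (S.g_symm _) hUx (chartBasis he hx)
  have huu' := huu
  rw [apply_eq_gram _ (chartBasis he hx), ← bilinComp_eq_gram] at huu hww huw
  rw [← bilinComp_eq_gram, ← formComp_eq_gram] at hc
  -- Positivity of `g` on the orthogonal complement of `u` is verified in the orthonormal frame.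
  refine Spacetime.exists_isAdaptedFrame (hU.isDualPair he hx) huu hww huw hc fun h huh h0 => ?_
  have hv := repr_vec he hx h
  rw [← hv, bilinComp_eq_gram S.g he hx, ← apply_eq_gram] at huh ⊢
  rw [apply_eq_gram _ (S.orthoFrame (e.symm x)), gram_orthoFrame] at huh huu' ⊢
  refine mink_pos_of_orthogonal huu' huh fun h1 => h0 ?_
  have : vec e x h = 0 := by
    rw [← (S.orthoFrame (e.symm x)).repr.map_eq_zero_iff]
    exact DFunLike.coe_injective h1
  rw [← hv, this, map_zero]
  rfl

end Manifold

section Manifold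

variable {M : Type*} [TopologicalSpace M] [ChartedSpace E4 M]

/-! ### The equivalence in a chart -/

theorem formComp_rotation {A U W : TwoForm M} {α β : M → ℝ}
    (hA : ∀ p, A p = Real.exp (α p) • (Real.cos (β p) • U p + Real.sin (β p) • W p))
    (e : OpenPartialHomeomorph M E4) :
    formComp A e = fun y =>
      (Real.exp (α (e.symm y)) * Real.cos (β (e.symm y))) • formComp U e y
        + (Real.exp (α (e.symm y)) * Real.sin (β (e.symm y))) • formComp W e y := by
  funext y
  ext i j
  simp only [formComp, Matrix.of_apply, Matrix.add_apply, Matrix.smul_apply, hA,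
    AlternatingMap.smul_apply, AlternatingMap.add_apply, smul_eq_mul]
  ring

theorem isCKY_iff (S : Spacetime M) {A : TwoForm M} (hA : A.IsSmooth) :
    S.IsCKY A ↔ ∀ e ∈ atlas E4 M, ∀ x ∈ e.target,
      CKYAt (bilinComp S.g e x) (nablaMatrix (bilinComp S.g e) (formComp A e) x) := by
  have key : ∀ e x, CKYAt (bilinComp S.g e x) (nablaMatrix (bilinComp S.g e) (formComp A e) x) ↔
      ∀ k i j,
        let G := bilinComp S.g e
        let a : Fin 4 → ℝ := fun l => 1 / 3 * divForm G (formComp A e) x l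
        1 / 2 * (nablaForm G (formComp A e) x k i j + nablaForm G (formComp A e) x i k j) =
          G x k i * a j - 1 / 2 * (a k * G x i j + a i * G x k j) := fun e x => by
    simp only [CKYAt, nablaMatrix_apply, divForm_eq_trace₃]
  simp only [key]
  exact ⟨fun h => h.eqn, fun h => ⟨hA, h⟩⟩

theorem isMaxwell_iff (S : Spacetime M) {F : TwoForm M} (hF : F.IsSmooth) :
    S.IsMaxwell F ↔ ∀ e ∈ atlas E4 M, ∀ x ∈ e.target,
      MaxwellAt (bilinComp S.g e x) (nablaMatrix (bilinComp S.g e) (formComp F e) x) := by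
  have key := fun e x => maxwellAt_nablaMatrix_iff (S.bilinComp_transpose e)
    (formComp_transpose F e) x
  simp only [key]
  exact ⟨fun h e he x hx => ⟨h.div_eq_zero e he x hx, h.closed e he x hx⟩,
    fun h => ⟨hF, fun e he x hx => (h e he x hx).1, fun e he x hx => (h e he x hx).2⟩⟩

variable [IsManifold (𝓡 4) ∞ M]

theorem isSmooth_rotation {A U W : TwoForm M} (hU : U.IsSmooth) (hW : W.IsSmooth) {α β : M → ℝ}
    (hα : ContMDiff (𝓡 4) 𝓘(ℝ, ℝ) ∞ α) (hβ : ContMDiff (𝓡 4) 𝓘(ℝ, ℝ) ∞ β)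
    (hA : ∀ p, A p = Real.exp (α p) • (Real.cos (β p) • U p + Real.sin (β p) • W p)) :
    A.IsSmooth := by
  intro e he i j
  have ha := contDiffOn_comp_chart hα he
  have hb := contDiffOn_comp_chart hβ he
  rw [formComp_rotation hA e]
  exact ((ha.exp.mul hb.cos).mul (hU e he i j)).add ((ha.exp.mul hb.sin).mul (hW e he i j))

/-! ### The planes of the 2+2 structure as kernels of 2-forms. -/

theorem vec_mem_spacePlane_iff (U : TwoForm M) {e : OpenPartialHomeomorph M E4}
    (he : e ∈ atlas E4 M) {x : E4} (hx : x ∈ e.target) (c : Fin 4 → ℝ) :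
    vec e x c ∈ spacePlane U (e.symm x) ↔ (formComp U e x).mulVec c = 0 := by
  have key : ∀ y, U (e.symm x) ![vec e x c, y] =
      -((formComp U e x).mulVec c ⬝ᵥ (chartBasis he hx).repr y) := fun y => by
    have h := apply_eq_gram (pairForm (U (e.symm x)) ![]) (chartBasis he hx) (vec e x c) y
    rw [repr_vec, ← formComp_eq_gram, Matrix.dotProduct_mulVec, ← Matrix.mulVec_transpose,
      formComp_transpose, Matrix.neg_mulVec, neg_dotProduct] at h
    exact h
  refine ⟨fun h => ?_, fun h y => by rw [key, h]; simp⟩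
  refine dotProduct_eq_zero _ fun v => ?_
  have := h (vec e x v)
  rwa [key, repr_vec, neg_eq_zero] at this

theorem g_vec_vec (S : Spacetime M) {e : OpenPartialHomeomorph M E4}
    (he : e ∈ atlas E4 M) {x : E4} (hx : x ∈ e.target) (X Y : Fin 4 → ℝ) :
    S.g (e.symm x) (vec e x X) (vec e x Y) = X ⬝ᵥ (bilinComp S.g e x).mulVec Y := by
  rw [apply_eq_gram _ (chartBasis he hx), repr_vec, repr_vec, ← bilinComp_eq_gram]

theorem dotProduct_mulVec_of_skew {B : Matrix (Fin 4) (Fin 4) ℝ}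
    (hB : B.transpose = -B) (x y : Fin 4 → ℝ) : x ⬝ᵥ B.mulVec y = -(B.mulVec x ⬝ᵥ y) := by
  rw [Matrix.dotProduct_mulVec, ← Matrix.mulVec_transpose, hB, Matrix.neg_mulVec, neg_dotProduct]

/-- The relation `(G⁻¹ * U)² - (G⁻¹ * W)² = 1` splits the identity into the projections onto the
kernels of `W` and `U`. They are algebraic in the components, hence smooth, and provide the
extending fields needed for umbilicity. -/
theorem IsDualPair.projection_of_dual_mulVec_eq_zero {G U W : Matrix (Fin 4) (Fin 4) ℝ}
    (h : IsDualPair G U W) {v : Fin 4 → ℝ} (hv : W.mulVec v = 0) :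
    (G⁻¹ * U * (G⁻¹ * U)).mulVec v = v := by
  have e : G⁻¹ * U * (G⁻¹ * U) = 1 + G⁻¹ * (W * G⁻¹) * W := by
    have : U * G⁻¹ * U = G + W * G⁻¹ * W := sub_eq_iff_eq_add.1 h.sub_eq
    rw [Matrix.mul_assoc, ← Matrix.mul_assoc U, this, Matrix.mul_add,
      Matrix.nonsing_inv_mul _ h.unit, Matrix.mul_assoc G⁻¹]
  rw [e, Matrix.add_mulVec, ← Matrix.mulVec_mulVec, hv]
  simp

theorem IsDualPair.projection_of_mulVec_eq_zero {G U W : Matrix (Fin 4) (Fin 4) ℝ}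
    (h : IsDualPair G U W) {v : Fin 4 → ℝ} (hv : U.mulVec v = 0) :
    (-(G⁻¹ * W * (G⁻¹ * W))).mulVec v = v := by
  have e : -(G⁻¹ * W * (G⁻¹ * W)) = 1 - G⁻¹ * (U * G⁻¹) * U := by
    have : W * G⁻¹ * W = U * G⁻¹ * U - G :=
      eq_sub_of_add_eq' (sub_eq_iff_eq_add.1 h.sub_eq).symm
    rw [Matrix.mul_assoc, ← Matrix.mul_assoc W, this, Matrix.mul_sub,
      Matrix.nonsing_inv_mul _ h.unit, Matrix.mul_assoc G⁻¹, neg_sub]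
  rw [e, Matrix.sub_mulVec, ← Matrix.mulVec_mulVec, hv]
  simp

/-- The image of `G⁻¹ * W` lies in the kernel of `U`, and orthogonality to this image already forces
`W c = 0`. Conversely, if `W c = 0` then `c` is fixed by `(G⁻¹ * U)²`, so `G c` lies in the image of
`U`, which annihilates the kernel of `U`. -/
theorem vec_mem_timePlane_iff {S : Spacetime M} {U : TwoForm M} (hU : S.IsUnitary U)
    {e : OpenPartialHomeomorph M E4} (he : e ∈ atlas E4 M) {x : E4} (hx : x ∈ e.target)
    (c : Fin 4 → ℝ) :
    vec e x c ∈ S.timePlane U (e.symm x) ↔ (formComp (S.hodge U) e x).mulVec c = 0 := by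
  have hP := hU.isDualPair he hx
  constructor
  · intro h
    refine dotProduct_eq_zero _ fun v => ?_
    have hd : (formComp U e x).mulVec
        (((bilinComp S.g e x)⁻¹ * formComp (S.hodge U) e x).mulVec v) = 0 := by
      rw [Matrix.mulVec_mulVec, ← Matrix.mul_assoc, hP.mul_dual, Matrix.zero_mulVec]
    have := h _ ((vec_mem_spacePlane_iff U he hx _).2 hd)
    rwa [g_vec_vec S he hx, Matrix.mulVec_mulVec, ← Matrix.mul_assoc,
      Matrix.mul_nonsing_inv _ hP.unit, Matrix.one_mul,
      dotProduct_mulVec_of_skew hP.skew_dual, neg_eq_zero] at this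
  · intro h y hy
    have hyv : y = vec e x ((chartBasis he hx).repr y) := by
      rw [vec_eq_sum he hx, Module.Basis.sum_repr]
    rw [hyv, vec_mem_spacePlane_iff U he hx] at hy
    have hc : (bilinComp S.g e x).mulVec c = (formComp U e x).mulVec
        (((bilinComp S.g e x)⁻¹ * formComp U e x).mulVec c) := by
      conv_lhs => rw [← hP.projection_of_dual_mulVec_eq_zero h]
      rw [Matrix.mulVec_mulVec, Matrix.mulVec_mulVec, ← Matrix.mul_assoc,
        ← Matrix.mul_assoc (bilinComp S.g e x), Matrix.mul_nonsing_inv _ hP.unit, Matrix.one_mul]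
    rw [S.g_symm, hyv, g_vec_vec S he hx, hc, dotProduct_mulVec_of_skew hP.skew, hy,
      zero_dotProduct, neg_zero]

/-- The umbilicity of a plane field that is the kernel of a smooth 2-form, in a chart. -/
theorem isUmbilicalPlane_iff (S : Spacetime M) {D : PlaneField M} {B : TwoForm M}
    (hB : B.IsSmooth)
    (hD : ∀ e ∈ atlas E4 M, ∀ x ∈ e.target, ∀ c, vec e x c ∈ D (e.symm x) ↔
      (formComp B e x).mulVec c = 0)
    (hP : ∀ e ∈ atlas E4 M, ∃ P : E4 → Matrix (Fin 4) (Fin 4) ℝ, SmoothMatrixOn P e.target ∧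
      (∀ y ∈ e.target, formComp B e y * P y = 0) ∧
      ∀ y ∈ e.target, ∀ v, (formComp B e y).mulVec v = 0 → (P y).mulVec v = v) :
    S.IsUmbilicalPlane D ↔ ∀ e ∈ atlas E4 M, ∀ x ∈ e.target,
      UmbilicalAt (bilinComp S.g e x) (formComp B e x)
        (nablaMatrix (bilinComp S.g e) (formComp B e) x) := by
  refine forall_congr' fun e => forall_congr' fun he => forall_congr' fun x =>
    forall_congr' fun hx => ?_
  obtain ⟨P, hPs, hBP, hPk⟩ := hP e he
  rw [umbilicalAt_iff_fields e.open_target (hB e he) hPs hBP hx (hPk x hx)]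
  refine exists_congr fun Z => forall_congr' fun X => forall_congr' fun Y =>
    imp_congr_right fun _ => imp_congr_right fun _ => ?_
  have ht : ∀ X : E4 → Fin 4 → ℝ, (∀ y ∈ e.target, vec e y (X y) ∈ D (e.symm y)) ↔
      ∀ y ∈ e.target, (formComp B e y).mulVec (X y) = 0 := fun X =>
    forall_congr' fun y => forall_congr' fun hy => hD e he y hy (X y)
  have hg : S.g (e.symm x) (vec e x (X x)) (vec e x (Y x)) =
      ∑ k, ∑ j, X x k * Y x j * bilinComp S.g e x k j := by
    rw [g_vec_vec S he hx]
    simp only [dotProduct, Matrix.mulVec, Finset.mul_sum]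
    exact Finset.sum_congr rfl fun k _ => Finset.sum_congr rfl fun j _ => by ring
  rw [ht, ht, hD e he x hx, hg]

theorem isUmbilical_iff {S : Spacetime M} {U : TwoForm M} (hU : S.IsUnitary U) :
    S.IsUmbilical U ↔ ∀ e ∈ atlas E4 M, ∀ x ∈ e.target,
      UmbilicalAt (bilinComp S.g e x) (formComp (S.hodge U) e x)
        (nablaMatrix (bilinComp S.g e) (formComp (S.hodge U) e) x) ∧
      UmbilicalAt (bilinComp S.g e x) (formComp U e x)
        (nablaMatrix (bilinComp S.g e) (formComp U e) x) := by
  have hW := S.smooth_hodge hU.smooth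
  have hI : ∀ e ∈ atlas E4 M, SmoothMatrixOn (fun y => (bilinComp S.g e y)⁻¹) e.target :=
    fun e he => SmoothMatrixOn.inv (T := bilinComp S.g e) (S.g_smooth e he)
      fun y hy => S.isUnit_det_bilinComp he hy
  have hV : S.IsUmbilicalPlane (S.timePlane U) ↔ _ := isUmbilicalPlane_iff S hW
    (fun e he x hx c => vec_mem_timePlane_iff hU he hx c) fun e he => by
      have hs := (hI e he).mul (T := formComp U e) (hU.smooth e he)
      refine ⟨_, hs.mul hs, fun y hy => ?_, fun y hy v hv =>
        (hU.isDualPair he hy).projection_of_dual_mulVec_eq_zero hv⟩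
      rw [← Matrix.mul_assoc, ← Matrix.mul_assoc (formComp (S.hodge U) e y),
        (hU.isDualPair he hy).dual_mul, Matrix.zero_mul]
  have hH : S.IsUmbilicalPlane (spacePlane U) ↔ _ := isUmbilicalPlane_iff S hU.smooth
    (fun e he x hx c => vec_mem_spacePlane_iff U he hx c) fun e he => by
      have hs := (hI e he).mul (T := formComp (S.hodge U) e) (hW e he)
      refine ⟨_, (hs.mul hs).neg, fun y hy => ?_, fun y hy v hv =>
        (hU.isDualPair he hy).projection_of_mulVec_eq_zero hv⟩
      rw [Matrix.mul_neg, ← Matrix.mul_assoc, ← Matrix.mul_assoc (formComp U e y),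
        (hU.isDualPair he hy).mul_dual, Matrix.zero_mul, neg_zero]
  rw [IsUmbilical, hV, hH]
  exact ⟨fun h e he x hx => ⟨h.1 e he x hx, h.2 e he x hx⟩,
    fun h => ⟨fun e he x hx => (h e he x hx).1, fun e he x hx => (h e he x hx).2⟩⟩

theorem exp_mul_cos_sq_add_exp_mul_sin_sq_ne_zero (a b : ℝ) :
    (Real.exp a * Real.cos b) ^ 2 + (Real.exp a * Real.sin b) ^ 2 ≠ 0 := by
  have : (Real.exp a * Real.cos b) ^ 2 + (Real.exp a * Real.sin b) ^ 2 = Real.exp a ^ 2 := by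
    linear_combination Real.exp a ^ 2 * Real.sin_sq_add_cos_sq b
  rw [this]
  positivity

end Manifold

end Spacetime

end

open Spacetime
theorem mainTheorem8 {M : Type*} [TopologicalSpace M] [ChartedSpace E4 M]
    [IsManifold (𝓡 4) ∞ M] (S : Spacetime M)
    (U : TwoForm M) (hU : S.IsUnitary U)
    (φ ψ : M → ℝ) (hφ : ContMDiff (𝓡 4) 𝓘(ℝ, ℝ) ∞ φ) (hψ : ContMDiff (𝓡 4) 𝓘(ℝ, ℝ) ∞ ψ)
    (A F : TwoForm M)
    (hA : ∀ p, A p =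
      Real.exp (φ p) • (Real.cos (ψ p) • U p + Real.sin (ψ p) • S.hodge U p))
    (hF : ∀ p, F p =
      Real.exp (-2 * φ p) • (Real.cos (2 * ψ p) • U p - Real.sin (2 * ψ p) • S.hodge U p)) :
    S.IsCKY A ↔ (S.IsMaxwell F ∧ S.IsUmbilical U) := by
  have hW := S.smooth_hodge hU.smooth
  have hφ' : ContMDiff (𝓡 4) 𝓘(ℝ, ℝ) ∞ fun p => -2 * φ p := contMDiff_const.mul hφ
  have hψ' : ContMDiff (𝓡 4) 𝓘(ℝ, ℝ) ∞ fun p => -2 * ψ p := contMDiff_const.mul hψ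
  -- With the angle `-2ψ` the form `F` has the same shape as `A`, so one formula for the covariant
  -- derivative serves both.
  have hF' : ∀ p, F p = Real.exp (-2 * φ p) •
      (Real.cos (-2 * ψ p) • U p + Real.sin (-2 * ψ p) • S.hodge U p) := fun p => by
    rw [hF, neg_mul 2 (ψ p), Real.cos_neg, Real.sin_neg]
    ext v
    simp only [AlternatingMap.smul_apply, AlternatingMap.sub_apply, AlternatingMap.add_apply,
      smul_eq_mul]
    ring
  rw [isCKY_iff S (isSmooth_rotation hU.smooth hW hφ hψ hA),
    isMaxwell_iff S (isSmooth_rotation hU.smooth hW hφ' hψ' hF'), isUmbilical_iff hU]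
  -- Both sides are now conditions at each point of each chart, and the equivalence already holds
  -- point by point.
  suffices h : ∀ e ∈ atlas E4 M, ∀ x ∈ e.target,
      (CKYAt (bilinComp S.g e x) (nablaMatrix (bilinComp S.g e) (formComp A e) x) ↔
        MaxwellAt (bilinComp S.g e x) (nablaMatrix (bilinComp S.g e) (formComp F e) x) ∧
        UmbilicalAt (bilinComp S.g e x) (formComp (S.hodge U) e x)
          (nablaMatrix (bilinComp S.g e) (formComp (S.hodge U) e) x) ∧
        UmbilicalAt (bilinComp S.g e x) (formComp U e x)
          (nablaMatrix (bilinComp S.g e) (formComp U e) x)) from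
    ⟨fun hc => ⟨fun e he x hx => ((h e he x hx).1 (hc e he x hx)).1,
        fun e he x hx => ((h e he x hx).1 (hc e he x hx)).2⟩,
      fun hm e he x hx => (h e he x hx).2 ⟨hm.1 e he x hx, hm.2 e he x hx⟩⟩
  intro e he x hx
  obtain ⟨D, hD⟩ := hU.exists_isAdaptedFrame he hx
  have ho := e.open_target
  have hG : SmoothMatrixOn (bilinComp S.g e) e.target := S.g_smooth e he
  have hUs : SmoothMatrixOn (formComp U e) e.target := hU.smooth e he
  have hWs : SmoothMatrixOn (formComp (S.hodge U) e) e.target := hW e he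
  have hP : ∀ y ∈ e.target, _ := fun y hy => hU.isDualPair he hy
  have dφ := differentiableAt_of_contDiffOn ho (contDiffOn_comp_chart hφ he) hx
  have dψ := differentiableAt_of_contDiffOn ho (contDiffOn_comp_chart hψ he) hx
  have dUx := hUs.diffMatrixAt ho hx
  have dWx := hWs.diffMatrixAt ho hx
  have two : ∀ (f : E4 → ℝ), DifferentiableAt ℝ f x → ∀ k,
      pd k (fun y => -2 * f y) x = -(2 * pd k f x) := fun f hf k => by
    rw [pd_mul (differentiableAt_const _) hf, pd_const]
    ring
  have key := CKYAt_iff hD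
    (fun k => nablaMatrix_transpose (formComp_transpose U e) x k)
    (fun k => nablaMatrix_transpose (formComp_transpose (S.hodge U) e) x k)
    (nablaMatrix_dual_constraint ho hG (S.bilinComp_transpose e) hUs hWs hP hx)
    (nablaMatrix_sub_constraint ho hG (S.bilinComp_transpose e) hUs hWs hP hx)
    (fun k => pd k (fun y => φ (e.symm y)) x) (fun k => pd k (fun y => ψ (e.symm y)) x)
    (exp_mul_cos_sq_add_exp_mul_sin_sq_ne_zero (φ (e.symm x)) (ψ (e.symm x)))
    (exp_mul_cos_sq_add_exp_mul_sin_sq_ne_zero (-2 * φ (e.symm x)) (-2 * ψ (e.symm x)))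
  have eA := funext fun k =>
    nablaMatrix_exp_rotation (G := bilinComp S.g e) dUx dWx dφ dψ k
  have eF := funext fun k =>
    nablaMatrix_exp_rotation (G := bilinComp S.g e) dUx dWx (dφ.const_mul (-2)) (dψ.const_mul (-2)) k
  simp only [two _ dφ, two _ dψ, neg_smul, ← sub_eq_add_neg, sub_neg_eq_add] at eF
  rw [formComp_rotation hA e, formComp_rotation hF' e]
  refine (iff_of_eq (congrArg (CKYAt _) eA)).trans (key.trans ?_)
  exact and_congr (iff_of_eq (congrArg (MaxwellAt _) eF)).symm Iff.rfl
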